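/- **Model.** Jobs evolve on a finite rooted tree $\mathcal S$ of states with root $r$ and $L$ levels (the root is level $0$, children are one level below their parent). A state $i$ has a holding cost $c(i)>0$; an unserved job in state $i$ moves to a child $k$ of $i$ with probability $P(i,k)>0$ and leaves the system (abandons) with probability $1-\sum_{k\text{ child of }i}P(i,k)$. Put $\theta=\min_{i\in\mathcal S}\bigl(1-\sum_{k\text{ child of }i}P(i,k)\bigr)$ and $c_{\max}=\max_{i\in\mathcal S} c(i)$, and assume $\theta>0$. Fix $\lambda\in(0,1)$ and $\mu\in(0,1]$. The system of size $N$ starts empty. In each period $t=1,2,\dots$: $R(t)\sim\mathrm{Bin}(N,\mu)$ servers become available; the algorithm selects a set of at most $R(t)$ waiting jobs, which leave without cost; every remaining job pays the holding cost of its current state and then makes a transition, independently of the others; finally $A(t)\sim\mathrm{Bin}(N,\lambda)$ new jobs arrive in state $r$. The variables $R(t)$ and $A(t)$ are independent over time, of each other and of the transitions. A feasible algorithm is any, possibly randomized, rule whose selection in period $t$ uses only $R(t)$, the waiting jobs and their current states, and the server capacities, queues, job states, selections and arrivals of the earlier periods. For a feasible algorithm $\mathrm A$ let $$C(N,\mathrm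 A)=\limsup_{T\to\infty}\frac1T\,\mathbb E\Bigl[\sum_{t=1}^T\ \sum_{j\text{ waiting and not selected in period }t}c(S_j(t))\Bigr],$$ where $S_j(t)$ is the state of job $j$ in period $t$, and let $\mathrm{Reg}(N,\mathrm A)=C(N,\mathrm A)-\inf_{\mathrm A'}C(N,\mathrm A')$, where the infimum is over all feasible algorithms. **Algorithm.** For $\gamma\ge0$ define $V(\gamma,\cdot)$ on $\mathcal S$ by $V(\gamma,i)=\min\{\gamma,\ c(i)+\sum_{k\text{ child of }i}P(i,k)V(\gamma,k)\}$, and let $\gamma^\star$ be any minimizer of $\mu\gamma-\lambda V(\gamma,r)$ over $\gamma\ge0$. The algorithm OaRC gives each state $i$ the index $c(i)+\sum_{k\text{ child of }i}P(i,k)V(\gamma^\star,k)$, fixes a total order of the states by decreasing index (ties between states broken in any way, fixed once and for all), and in each period serves as many waiting jobs as there are available servers, or all of them if there are fewer, in that order. **Theorem.** OaRC is well defined (a minimizer $\gamma^\star$ exists), its cost $C(N,\mathrm{OaRC})$ is finite, and OaRC is asymptotically optimal: $\mathrm{Reg}(N,\mathrm{OaRC})/N\to0$ as $N\to\infty$,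 for fixed $\mathcal S,c,P,\lambda,\mu$. Moreover, for every integer $N\ge1$, $$\mathrm{Reg}(N,\mathrm{OaRC})\le c_{\max}\cdot1610\,\theta^{-2}L^{1.5}\ln^2(55NL)\,\sqrt N .$$ -/

import Mathlib

open scoped ENNReal

namespace UncertainCostQueue

/-! ### The tree-structured Markov chain of a job -/

/-- A tree-structured Markov chain of holding costs on a finite state space `S`, with levels.
The mass missing from row `i` of `P` is the probability of moving from `i` to the empty state,
i.e. of abandoning the system. -/
structure TreeChain (S : Type*) [Fintype S] [DecidableEq S] where
  /-- instantaneous holding cost of a state -/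
  cost : S → ℝ
  /-- transition probabilities between (non-empty) states -/
  P : S → S → ℝ
  /-- the level of a state in the tree -/
  level : S → ℕ
  root : S
  /-- the parent of a state; only the root has none -/
  parent : S → Option S
  cost_pos : ∀ i, 0 < cost i
  level_eq_zero : ∀ i, level i = 0 ↔ i = root
  parent_eq_none : ∀ i, parent i = none ↔ i = root
  level_of_parent : ∀ i k, parent i = some k → level i = level k + 1
  P_pos : ∀ i k, parent i = some k → 0 < P k i
  P_eq_zero : ∀ i k, parent i ≠ some k → P k i = 0
  sum_P_le_one : ∀ i, ∑ k, P i k ≤ 1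

namespace TreeChain

variable {S : Type*} [Fintype S] [DecidableEq S] (M : TreeChain S)

/-- The children of a state. -/
def child (i : S) : Finset S := Finset.univ.filter fun k => M.parent k = some i

/-- `L`, the number of levels of the tree. -/
def numLevels : ℕ := Finset.univ.sup M.level + 1

/-- The probability to abandon from state `i`. -/
def abandonProb (i : S) : ℝ := 1 - ∑ k ∈ M.child i, M.P i k

/-- `θ`, the minimum abandonment probability. -/
noncomputable def minAbandonProb : ℝ :=
  Finset.univ.inf' ⟨M.root, Finset.mem_univ _⟩ M.abandonProb

/-- `c_max`, the maximum instantaneous holding cost. -/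
noncomputable def maxCost : ℝ :=
  Finset.univ.sup' ⟨M.root, Finset.mem_univ _⟩ M.cost

theorem P_nonneg (i k : S) : 0 ≤ M.P i k := by
  by_cases h : M.parent k = some i
  · exact (M.P_pos k i h).le
  · exact (M.P_eq_zero k i h).ge

theorem sum_child (i : S) : ∑ k ∈ M.child i, M.P i k = ∑ k, M.P i k := by
  refine Finset.sum_subset (Finset.subset_univ _) fun k _ hk => M.P_eq_zero k i ?_
  simpa [child] using hk

theorem abandonProb_nonneg (i : S) : 0 ≤ M.abandonProb i := by
  have := M.sum_P_le_one i
  rw [abandonProb, sum_child]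
  linarith

/-- The law of the next state of an unserved job whose current state is `i`;
`none` is the empty state, i.e. abandonment. -/
noncomputable def next (i : S) : PMF (Option S) :=
  PMF.ofFintype
    (fun o => o.elim (ENNReal.ofReal (M.abandonProb i)) fun k => ENNReal.ofReal (M.P i k)) (by
      rw [Fintype.sum_option]
      simp only [Option.elim]
      rw [← ENNReal.ofReal_sum_of_nonneg fun k _ => M.P_nonneg i k,
        ← ENNReal.ofReal_add (M.abandonProb_nonneg i)
          (Finset.sum_nonneg fun k _ => M.P_nonneg i k),
        abandonProb, sum_child]
      simp)

theorem level_lt_numLevels (i : S) : M.level i < M.numLevels :=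
  Nat.lt_succ_of_le (Finset.le_sup (f := M.level) (Finset.mem_univ i))

/-- The cost-to-go `V(γ, i)` of the Markovian ski-rental problem with price `γ`, i.e. the solution
of the Bellman equation `V(γ, i) = min {γ, c(i) + ∑_{k child of i} P(i, k) V(γ, k)}`. -/
noncomputable def costToGo (γ : ℝ) (i : S) : ℝ :=
  min γ (M.cost i + ∑ k : M.child i, M.P i k * costToGo γ k)
termination_by M.numLevels - M.level i
decreasing_by
  have hk : M.parent k = some i := by simpa [child] using k.2
  have h1 := M.level_of_parent _ _ hk
  have h2 := M.level_lt_numLevels k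
  omega

/-- The future cost-to-go `V^f(γ, i)`. -/
noncomputable def futureCostToGo (γ : ℝ) (i : S) : ℝ :=
  ∑ k ∈ M.child i, M.P i k * M.costToGo γ k

/-- The Bellman equation. -/
theorem costToGo_eq (γ : ℝ) (i : S) :
    M.costToGo γ i = min γ (M.cost i + M.futureCostToGo γ i) := by
  rw [costToGo, futureCostToGo,
    ← Finset.sum_coe_sort (M.child i) fun k => M.P i k * M.costToGo γ k]

/-- The index of state `i` at price `γ`. -/
noncomputable def index (γ : ℝ) (i : S) : ℝ := M.cost i + M.futureCostToGo γ i

end TreeChain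

/-! ### Jobs, queues and scheduling algorithms -/

/-- The identity of a job: the period at the end of which it arrives, and a serial number among
the jobs arriving in that period. -/
abbrev Job := ℕ × ℕ

/-- The waiting jobs together with their current states. -/
structure Queue (S : Type*) where
  jobs : Finset Job
  state : jobs → S

/-- What is observed in one period: the number of available servers, the waiting jobs and
their states, the set of jobs selected for service, and the set of new jobs. -/
structure Record (S : Type*) where
  capacity : ℕ
  queue : Queue S
  served : Finset Job
  arrivals : Finset Job

/-- A feasible (possibly randomized) scheduling algorithm. Given the records of all earlier
periods (most recent first), the number of available servers and the current queue, it selects a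
set of at most that many waiting jobs. -/
structure FeasiblePolicy (S : Type*) where
  select : List (Record S) → ℕ → Queue S → PMF (Finset Job)
  subset_jobs : ∀ past r q, ∀ s ∈ (select past r q).support, s ⊆ q.jobs
  card_le : ∀ past r q, ∀ s ∈ (select past r q).support, s.card ≤ r

/-- The algorithm serves waiting jobs in the priority ordering of states given by the positions
`pos` (the state of highest priority has position `0`), using as many servers as possible. Which
ones among jobs in the same state are served is left to the algorithm. -/
def FeasiblePolicy.FollowsPriority {S : Type*} [Fintype S] (π : FeasiblePolicy S)
    (pos : S ≃ Fin (Fintype.card S)) : Prop :=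
  ∀ past r q, ∀ s ∈ (π.select past r q).support,
    s.card = min r q.jobs.card ∧
      ∀ j j' : q.jobs, (j : Job) ∈ s → (j' : Job) ∉ s → pos (q.state j) ≤ pos (q.state j')

/-- The joint law of independent random variables with the given laws. -/
noncomputable def independentLaw {ι α : Type*} [Fintype ι] [DecidableEq ι] [Fintype α]
    (p : ι → PMF α) : PMF (ι → α) :=
  PMF.ofFintype (fun f => ∏ j, p j (f j)) (by
    rw [← Fintype.prod_sum fun j a => p j a]
    refine Finset.prod_eq_one fun j _ => ?_
    rw [← tsum_fintype (L := .unconditional _)]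
    exact (p j).tsum_coe)

/-- The `n` jobs that arrive in period `t`. -/
def newJobs (t n : ℕ) : Finset Job := (Finset.range n).image fun a => (t, a)

/-- The total holding cost of a period: the cost of all jobs that are waiting and not served. -/
noncomputable def Record.holdingCost {S : Type*} (c : S → ℝ) (h : Record S) : ℝ :=
  ∑ j : h.queue.jobs, if (j : Job) ∈ h.served then 0 else c (h.queue.state j)

/-! ### The queueing system -/

/-- The primitives of the queueing system, except its size. -/
structure Model (S : Type*) [Fintype S] [DecidableEq S] extends TreeChain S where
  /-- normalized arrival rate `λ` -/
  arrivalRate : unitInterval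
  /-- normalized service rate `μ` -/
  serviceRate : unitInterval
  arrivalRate_pos : 0 < arrivalRate
  arrivalRate_lt_one : arrivalRate < 1
  serviceRate_pos : 0 < serviceRate

namespace Model

variable {S : Type*} [Fintype S] [DecidableEq S] (M : Model S)

/-- The law of `Bin(N, μ)`, the number of servers available in a period. -/
noncomputable def capacityLaw (N : ℕ) : PMF ℕ :=
  (ProbabilityTheory.binomial N M.serviceRate).toPMF

/-- The law of `Bin(N, λ)`, the number of arrivals in a period. -/
noncomputable def arrivalLaw (N : ℕ) : PMF ℕ :=
  (ProbabilityTheory.binomial N M.arrivalRate).toPMF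

/-- The queue of the next period, when `f` gives the new states of the unserved jobs and `new` is
the set of new jobs: unserved jobs that did not abandon, in their new states, and the new jobs, in
the root state. -/
def nextQueue (q : Queue S) (served : Finset Job) (f : ↥(q.jobs \ served) → Option S)
    (new : Finset Job) : Queue S where
  jobs := (Finset.univ.filter fun j => (f j).isSome).map (Function.Embedding.subtype _) ∪ new
  state j := if h : (j : Job) ∈ q.jobs \ served then (f ⟨j, h⟩).getD M.root else M.root

/-- The unserved jobs of a queue transition independently of each other. -/
noncomputable def transitionLaw (q : Queue S) (served : Finset Job) :
    PMF (↥(q.jobs \ served) → Option S) :=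
  independentLaw fun j => M.next (q.state ⟨j, (Finset.mem_sdiff.1 j.2).1⟩)

/-- One period of the system of size `N`, from the records of the earlier periods and the
current queue to the records including this period and the next queue. -/
noncomputable def step (N : ℕ) (π : FeasiblePolicy S) (x : List (Record S) × Queue S) :
    PMF (List (Record S) × Queue S) :=
  (M.capacityLaw N).bind fun r =>
    (π.select x.1 r x.2).bind fun served =>
      (M.transitionLaw x.2 served).bind fun f =>
        (M.arrivalLaw N).map fun n =>
          let new := newJobs (x.1.length + 1) n
          (⟨r, x.2, served, new⟩ :: x.1, M.nextQueue x.2 served f new)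

/-- The joint law of the records of the periods `1, …, T` and the queue of period `T + 1`, for the
system of size `N` under the algorithm `π`, started with no waiting job. -/
noncomputable def law (N : ℕ) (π : FeasiblePolicy S) : ℕ → PMF (List (Record S) × Queue S)
  | 0 => PMF.pure ([], ⟨∅, fun _ => M.root⟩)
  | T + 1 => (law N π T).bind (M.step N π)

/-- The expected total holding cost of the periods `1, …, T`. -/
noncomputable def expectedCost (N : ℕ) (π : FeasiblePolicy S) (T : ℕ) : ℝ≥0∞ :=
  ∑' x, M.law N π T x * ENNReal.ofReal (x.1.map (Record.holdingCost M.cost)).sum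

/-- The long-run average holding cost `C(N, π)`. -/
noncomputable def longRunCost (N : ℕ) (π : FeasiblePolicy S) : ℝ≥0∞ :=
  Filter.limsup (fun T : ℕ => M.expectedCost N π T / T) Filter.atTop

/-- The least long-run average holding cost over all feasible algorithms. -/
noncomputable def optimalCost (N : ℕ) : ℝ≥0∞ := ⨅ π : FeasiblePolicy S, M.longRunCost N π

/-- The regret of `π` in the system of size `N` (meaningful when `C(N, π)` is finite). -/
noncomputable def regret (N : ℕ) (π : FeasiblePolicy S) : ℝ :=
  (M.longRunCost N π).toReal - (M.optimalCost N).toReal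

/-- Asymptotic optimality of a family of algorithms, one for each system size. -/
def AsymptoticallyOptimal (π : ℕ → FeasiblePolicy S) : Prop :=
  Filter.Tendsto (fun N : ℕ => M.regret N (π N) / N) Filter.atTop (nhds 0)

/-- `γ` is an optimal capacity price: it minimizes `μ γ - λ V(γ, root)` over `γ ≥ 0`. -/
def IsCapacityPrice (γ : ℝ) : Prop :=
  0 ≤ γ ∧ IsMinOn (fun x : ℝ => (M.serviceRate : ℝ) * x - M.arrivalRate * M.costToGo x M.root)
    (Set.Ici 0) γ

/-- `π` is the algorithm OaRC (opportunity-adjusted remaining cost): for some optimal capacity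
price and some consistent tie-breaking, it serves jobs in decreasing order of the index of
their state. -/
def IsOaRC (π : FeasiblePolicy S) : Prop :=
  ∃ γ, M.IsCapacityPrice γ ∧ ∃ pos : S ≃ Fin (Fintype.card S),
    (∀ i k, M.index γ k < M.index γ i → pos i < pos k) ∧ π.FollowsPriority pos

end Model

end UncertainCostQueue

/-! The proof is linear programming duality with price `γ` on a server, combined with drift
arguments. Let `v = N (λ V(γ, r) - μ γ)`, and take as potential the sum of `V(γ, ·)` over the
waiting jobs. A served job removes at most `γ` from the potential; an unserved job in state `i`
satisfies `V(γ, i) ≤ c(i) + (P V)(i)` by the Bellman equation. Summing over time, every feasible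
algorithm pays at least `v` per period, up to a boundary term independent of the horizon
(`le_sum_meanCost_add`).

For OaRC the same inequalities run backwards with two defects (`sum_meanCost_le`): jobs left
unserved in states of index above `γ`, each costing at most `c_max / θ`, and servers not used for
states of index at least `γ`, each costing at most `γ`. Both are controlled by the first-order
conditions at the minimizer `γ`. The one-sided derivatives of `V(·, r)` are hitting probabilities,
so the jobs reaching index `> γ` do not exceed the capacity on average, while for `γ > 0` those
reaching index `≥ γ` suffice to fill it.

What remains is a stochastic estimate for a set `A` of states closed under higher priority: either
all jobs in `A` are served, or all servers work on `A`. Split the jobs in `A` into first and later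
visits. The number of first visits exceeds its fluid mean only by fluctuations
(`mean_total_sub_le`), and falls below it only by fluctuations and by jobs served before reaching
`A` (`sum_mean_sub_total_le`). Later visits come from jobs left unserved in `A`, and lost first
visits from servers not used for `A`. In both cases abandonment passes on at most a fraction `1 - θ`
of the quantity being estimated, so it can be absorbed on the left, at the price of a factor `1/θ`
(`sum_mean_unserved_le`, `sum_mean_idle_le`).

Fluctuations cost at most `2 √(N L)` per level in first absolute moment
(`mean_lipschitz_total_succ_le`). This gives regret at most `2 c_max θ⁻² (√N + 2 L √(N L))`, which
has no logarithm and is stronger than the claim. -/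

/-! ### Expectations under finitely supported laws -/

namespace PMF

variable {α β : Type*}

/-- The law has finite support. -/
class FinitelySupported (p : PMF α) : Prop where
  finite : p.support.Finite

/-- The expectation of a real function; meaningful for finitely supported laws. -/
noncomputable def expect (p : PMF α) (f : α → ℝ) : ℝ := ∑' x, (p x).toReal * f x

theorem expect_eq_sum {p : PMF α} {t : Finset α} (h : p.support ⊆ t) (f : α → ℝ) :
    p.expect f = ∑ x ∈ t, (p x).toReal * f x := by
  refine tsum_eq_sum fun x hx => ?_
  have : p x = 0 := (p.apply_eq_zero_iff x).2 fun hs => hx (h hs)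
  simp [this]

theorem sum_toReal {p : PMF α} {t : Finset α} (h : p.support ⊆ t) :
    ∑ x ∈ t, (p x).toReal = 1 := by
  rw [← ENNReal.toReal_sum fun x _ => p.apply_ne_top x, ← ENNReal.toReal_one]
  congr 1
  rw [← p.tsum_coe]
  exact (tsum_eq_sum fun x hx => (p.apply_eq_zero_iff x).2 fun hs => hx (h hs)).symm

/-- The support as a finite set. -/
noncomputable def suppFinset (p : PMF α) [h : p.FinitelySupported] : Finset α := h.finite.toFinset

theorem support_subset_suppFinset (p : PMF α) [h : p.FinitelySupported] :
    p.support ⊆ (p.suppFinset : Set α) := by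
  intro x hx
  simpa [suppFinset] using hx

theorem mem_suppFinset {p : PMF α} [h : p.FinitelySupported] {x : α} :
    x ∈ p.suppFinset ↔ x ∈ p.support := by
  simp [suppFinset]

instance (a : α) : (pure a).FinitelySupported := ⟨by simp⟩

instance [Finite α] (p : PMF α) : p.FinitelySupported := ⟨Set.toFinite _⟩

instance (p : PMF α) [p.FinitelySupported] (q : α → PMF β) [∀ a, (q a).FinitelySupported] :
    (p.bind q).FinitelySupported := by
  refine ⟨?_⟩
  rw [support_bind]
  exact (FinitelySupported.finite (p := p)).biUnion fun a _ => FinitelySupported.finite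

instance (p : PMF α) [p.FinitelySupported] (g : α → β) : (p.map g).FinitelySupported := by
  refine ⟨?_⟩
  rw [support_map]
  exact (FinitelySupported.finite (p := p)).image _

section

variable (p : PMF α) [p.FinitelySupported]

theorem expect_add (f g : α → ℝ) :
    p.expect (fun x => f x + g x) = p.expect f + p.expect g := by
  simp only [expect_eq_sum p.support_subset_suppFinset, mul_add, Finset.sum_add_distrib]

theorem expect_const_mul (c : ℝ) (f : α → ℝ) :
    p.expect (fun x => c * f x) = c * p.expect f := by
  simp only [expect_eq_sum p.support_subset_suppFinset, Finset.mul_sum, mul_left_comm]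

theorem expect_sub (f g : α → ℝ) :
    p.expect (fun x => f x - g x) = p.expect f - p.expect g := by
  simp only [expect_eq_sum p.support_subset_suppFinset, mul_sub, Finset.sum_sub_distrib]

theorem expect_const (c : ℝ) : p.expect (fun _ => c) = c := by
  rw [expect_eq_sum p.support_subset_suppFinset, ← Finset.sum_mul,
    sum_toReal p.support_subset_suppFinset, one_mul]

theorem expect_finset_sum {ι : Type*} (s : Finset ι) (f : ι → α → ℝ) :
    p.expect (fun x => ∑ i ∈ s, f i x) = ∑ i ∈ s, p.expect (f i) := by
  simp only [expect_eq_sum p.support_subset_suppFinset, Finset.mul_sum]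
  exact Finset.sum_comm

variable {p} in
theorem expect_mono {f g : α → ℝ} (h : ∀ x ∈ p.support, f x ≤ g x) : p.expect f ≤ p.expect g := by
  simp only [expect_eq_sum p.support_subset_suppFinset]
  exact Finset.sum_le_sum fun x hx =>
    mul_le_mul_of_nonneg_left (h x (mem_suppFinset.1 hx)) ENNReal.toReal_nonneg

variable {p} in
theorem expect_congr {f g : α → ℝ} (h : ∀ x ∈ p.support, f x = g x) : p.expect f = p.expect g :=
  le_antisymm (expect_mono fun x hx => (h x hx).le) (expect_mono fun x hx => (h x hx).ge)

variable {p} in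
theorem expect_nonneg {f : α → ℝ} (h : ∀ x ∈ p.support, 0 ≤ f x) : 0 ≤ p.expect f := by
  rw [← p.expect_const 0]
  exact expect_mono h

theorem expect_bind (q : α → PMF β) [∀ a, (q a).FinitelySupported] (f : β → ℝ) :
    (p.bind q).expect f = p.expect fun a => (q a).expect f := by
  classical
  have hq : ∀ a ∈ p.suppFinset, (q a).support ⊆ ((p.bind q).suppFinset : Set β) := by
    intro a ha b hb
    rw [Finset.mem_coe, mem_suppFinset, mem_support_bind_iff]
    exact ⟨a, mem_suppFinset.1 ha, hb⟩
  have hb : ∀ b, ((p.bind q) b).toReal = ∑ a ∈ p.suppFinset, (p a).toReal * (q a b).toReal := by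
    intro b
    rw [bind_apply, tsum_eq_sum (s := p.suppFinset), ENNReal.toReal_sum]
    · simp only [ENNReal.toReal_mul]
    · exact fun a _ => ENNReal.mul_ne_top (p.apply_ne_top a) ((q a).apply_ne_top b)
    · intro a ha
      rw [(p.apply_eq_zero_iff a).2 fun hs => ha (mem_suppFinset.2 hs), zero_mul]
  rw [expect_eq_sum (p.bind q).support_subset_suppFinset,
    expect_eq_sum p.support_subset_suppFinset]
  simp only [hb, Finset.sum_mul]
  rw [Finset.sum_comm]
  refine Finset.sum_congr rfl fun a ha => ?_
  rw [expect_eq_sum (hq a ha), Finset.mul_sum]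
  exact Finset.sum_congr rfl fun b _ => mul_assoc _ _ _

theorem expect_map (g : α → β) (f : β → ℝ) :
    (p.map g).expect f = p.expect fun a => f (g a) := by
  have h := p.expect_bind (fun a => pure (g a)) f
  have h2 : (p.bind fun a => pure (g a)) = p.map g := rfl
  rw [h2] at h
  rw [h]
  congr 1
  funext a
  rw [expect_eq_sum (t := {g a}) (by simp)]
  simp

/-- Bridge between the extended nonnegative sums defining the costs and the real expectations used
in all estimates. -/
theorem tsum_mul_ofReal {f : α → ℝ} (hf : ∀ x, 0 ≤ f x) :
    ∑' x, p x * ENNReal.ofReal (f x) = ENNReal.ofReal (p.expect f) := by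
  rw [expect_eq_sum p.support_subset_suppFinset, tsum_eq_sum (s := p.suppFinset),
    ENNReal.ofReal_sum_of_nonneg fun x _ => mul_nonneg ENNReal.toReal_nonneg (hf x)]
  · refine Finset.sum_congr rfl fun x _ => ?_
    rw [ENNReal.ofReal_mul ENNReal.toReal_nonneg, ENNReal.ofReal_toReal (p.apply_ne_top x)]
  · intro x hx
    rw [(p.apply_eq_zero_iff x).2 fun hs => hx (mem_suppFinset.2 hs), zero_mul]

/-- The first absolute moment is bounded through the second moment. -/
theorem expect_abs_le {a v : ℝ} (ha : 0 < a) {f : α → ℝ} (h : p.expect (fun x => f x ^ 2) ≤ v) :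
    p.expect (fun x => |f x|) ≤ v / (2 * a) + a / 2 := by
  calc p.expect (fun x => |f x|) ≤ p.expect (fun x => (2 * a)⁻¹ * f x ^ 2 + a / 2) := by
        refine expect_mono fun x _ => ?_
        -- Completing the square replaces Cauchy–Schwarz; `a` plays the role of the standard
        -- deviation.
        have h1 : (2 * a)⁻¹ * f x ^ 2 + a / 2 - |f x| = (2 * a)⁻¹ * (|f x| - a) ^ 2 := by
          rw [← sq_abs (f x)]
          field_simp
          ring
        have h2 : 0 ≤ (2 * a)⁻¹ * (|f x| - a) ^ 2 := by positivity
        linarith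
    _ = (2 * a)⁻¹ * p.expect (fun x => f x ^ 2) + a / 2 := by
        rw [expect_add, expect_const_mul, expect_const]
    _ ≤ v / (2 * a) + a / 2 := by
        rw [div_eq_inv_mul v]
        have : 0 ≤ (2 * a)⁻¹ := by positivity
        gcongr

end

theorem expect_pure (a : α) (f : α → ℝ) : (pure a).expect f = f a := by
  rw [expect_eq_sum (t := {a}) (by simp)]
  simp

end PMF

/-! ### Independent laws and binomial laws -/

namespace UncertainCostQueue

section independentLaw

variable {ι α : Type*} [Fintype ι] [DecidableEq ι] [Fintype α]

/-- Product test functions are enough: factors equal to `1` outside one or two coordinates give the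
marginals and the factorization over two distinct coordinates. -/
theorem expect_independentLaw_prod (p : ι → PMF α) (h : ι → α → ℝ) :
    (independentLaw p).expect (fun f => ∏ j, h j (f j)) = ∏ j, (p j).expect (h j) := by
  classical
  rw [PMF.expect_eq_sum (t := Finset.univ) (by simp)]
  simp only [PMF.expect_eq_sum (t := (Finset.univ : Finset α)) (fun _ _ => by simp),
    Fintype.prod_sum]
  refine Finset.sum_congr rfl fun f _ => ?_
  simp [independentLaw, ENNReal.toReal_prod, Finset.prod_mul_distrib]

theorem expect_independentLaw_apply (p : ι → PMF α) (i : ι) (h : α → ℝ) :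
    (independentLaw p).expect (fun f => h (f i)) = (p i).expect h := by
  have key := expect_independentLaw_prod p fun j a => if j = i then h a else 1
  have h2 : ∀ j, (p j).expect (fun a => if j = i then h a else 1) =
      if j = i then (p i).expect h else 1 := by
    intro j
    split_ifs with hj
    · rw [hj]
    · exact PMF.expect_const _ 1
  simpa [h2] using key

theorem expect_independentLaw_mul (p : ι → PMF α) {i k : ι} (hik : i ≠ k) (g h : α → ℝ) :
    (independentLaw p).expect (fun f => g (f i) * h (f k)) =
      (p i).expect g * (p k).expect h := by
  have key := expect_independentLaw_prod p fun j a =>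
    (if j = i then g a else 1) * (if j = k then h a else 1)
  have h2 : ∀ j, (p j).expect (fun a => (if j = i then g a else 1) * (if j = k then h a else 1)) =
      (if j = i then (p i).expect g else 1) * (if j = k then (p k).expect h else 1) := by
    intro j
    by_cases hi : j = i
    · subst hi
      simp [hik]
    · by_cases hk : j = k
      · subst hk
        simp [hi]
      · simpa [hi, hk] using PMF.expect_const (p j) 1
  simpa only [h2, Finset.prod_mul_distrib, Finset.prod_ite_eq', Finset.mem_univ, if_true] using key

/-- The mean of a sum of independent random variables. -/
theorem expect_independentLaw_sum (p : ι → PMF α) (h : ι → α → ℝ) :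
    (independentLaw p).expect (fun f => ∑ j, h j (f j)) = ∑ j, (p j).expect (h j) := by
  rw [PMF.expect_finset_sum]
  exact Finset.sum_congr rfl fun j _ => expect_independentLaw_apply p j (h j)

/-- The variance of a sum of independent random variables with values in the unit interval is at
most their number. -/
theorem expect_independentLaw_sq_le (p : ι → PMF α) (h : ι → α → ℝ)
    (h0 : ∀ j a, 0 ≤ h j a) (h1 : ∀ j a, h j a ≤ 1) :
    (independentLaw p).expect (fun f => (∑ j, (h j (f j) - (p j).expect (h j))) ^ 2) ≤
      Fintype.card ι := by
  have hmean : ∀ j, (p j).expect (fun a => h j a - (p j).expect (h j)) = 0 := by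
    intro j
    rw [PMF.expect_sub, PMF.expect_const, sub_self]
  have hdiag : ∀ j, (p j).expect (fun a => (h j a - (p j).expect (h j)) ^ 2) ≤ 1 := by
    intro j
    have e0 : 0 ≤ (p j).expect (h j) := PMF.expect_nonneg fun a _ => h0 j a
    have e1 : (p j).expect (h j) ≤ 1 := by
      rw [← PMF.expect_const (p j) 1]
      exact PMF.expect_mono fun a _ => h1 j a
    rw [← PMF.expect_const (p j) 1]
    refine PMF.expect_mono fun a _ => ?_
    nlinarith [h0 j a, h1 j a]
  calc (independentLaw p).expect (fun f => (∑ j, (h j (f j) - (p j).expect (h j))) ^ 2)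
      = ∑ i, ∑ k, (independentLaw p).expect (fun f =>
          (h i (f i) - (p i).expect (h i)) * (h k (f k) - (p k).expect (h k))) := by
        simp only [sq, Finset.sum_mul_sum, PMF.expect_finset_sum]
    _ = ∑ i, (p i).expect (fun a => (h i a - (p i).expect (h i)) ^ 2) := by
        refine Finset.sum_congr rfl fun i _ => ?_
        rw [Finset.sum_eq_single i]
        · simp only [← sq]
          exact expect_independentLaw_apply p i fun a => (h i a - (p i).expect (h i)) ^ 2
        · intro k _ hk
          -- Centred coordinates are uncorrelated, so only the diagonal of the square survives.
          rw [expect_independentLaw_mul p hk.symm (fun a => h i a - (p i).expect (h i))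
            (fun a => h k a - (p k).expect (h k)), hmean, zero_mul]
        · simp
    _ ≤ ∑ _i : ι, (1 : ℝ) := Finset.sum_le_sum fun i _ => hdiag i
    _ = Fintype.card ι := by simp

end independentLaw

section binomial

variable (N : ℕ) (p : unitInterval)

open ProbabilityTheory

/-- Turns the binomial mean and variance into the known Bernstein polynomial identities. -/
theorem toPMF_binomial_toReal (k : ℕ) :
    ((binomial N p).toPMF k).toReal = ((bernsteinPolynomial ℝ N k).eval (p : ℝ)) := by
  rw [MeasureTheory.Measure.toPMF_apply, ← MeasureTheory.measureReal_def, binomial_real_singleton]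
  simp [bernsteinPolynomial]

theorem support_toPMF_binomial :
    ((binomial N p).toPMF).support ⊆ (Finset.range (N + 1) : Set ℕ) := by
  intro k hk
  by_contra hlt
  have h : N < k := by simpa using hlt
  refine hk ?_
  rw [MeasureTheory.Measure.toPMF_apply, binomial_singleton, Nat.choose_eq_zero_of_lt h]
  simp

instance : ((binomial N p).toPMF).FinitelySupported :=
  ⟨(Finset.finite_toSet _).subset (support_toPMF_binomial N p)⟩

theorem expect_binomial_id : ((binomial N p).toPMF).expect (fun k => (k : ℝ)) = N * p := by
  have h := congrArg (Polynomial.eval (p : ℝ)) (bernsteinPolynomial.sum_smul ℝ N)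
  rw [PMF.expect_eq_sum (support_toPMF_binomial N p)]
  simp only [toPMF_binomial_toReal]
  simpa [Polynomial.eval_finsetSum, mul_comm] using h

theorem expect_binomial_sq_le :
    ((binomial N p).toPMF).expect (fun k => ((k : ℝ) - N * p) ^ 2) ≤ N := by
  have h := congrArg (Polynomial.eval (p : ℝ)) (bernsteinPolynomial.variance ℝ N)
  rw [PMF.expect_eq_sum (support_toPMF_binomial N p)]
  simp only [toPMF_binomial_toReal]
  have h2 : ∑ x ∈ Finset.range (N + 1), Polynomial.eval (p : ℝ) (bernsteinPolynomial ℝ N x) *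
      ((x : ℝ) - N * p) ^ 2 = N * p * (1 - p) := by
    rw [← show _ = (N : ℝ) * p * (1 - p) by simpa [Polynomial.eval_finsetSum] using h]
    exact Finset.sum_congr rfl fun x _ => by ring
  rw [h2]
  have hp0 := p.2.1
  have hp1 := p.2.2
  have : (p : ℝ) * (1 - p) ≤ 1 := by nlinarith
  calc (N : ℝ) * p * (1 - p) = N * (p * (1 - p)) := by ring
    _ ≤ N * 1 := by gcongr
    _ = N := mul_one _

end binomial

end UncertainCostQueue

namespace UncertainCostQueue

namespace TreeChain

variable {S : Type*} [Fintype S] [DecidableEq S] (M : TreeChain S)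

/-! ### The transition operator -/

/-- The transition operator `w ↦ P w` on functions of the state. -/
noncomputable def push : Module.End ℝ (S → ℝ) := Matrix.mulVecLin (Matrix.of M.P)

theorem push_apply (w : S → ℝ) (i : S) : M.push w i = ∑ k, M.P i k * w k := by
  simp [push, Matrix.mulVec, dotProduct]

theorem sum_child_mul (w : S → ℝ) (i : S) : ∑ k ∈ M.child i, M.P i k * w k = M.push w i := by
  rw [push_apply]
  refine Finset.sum_subset (Finset.subset_univ _) fun k _ hk => ?_
  rw [M.P_eq_zero k i (by simpa [child] using hk), zero_mul]

theorem push_congr {v w : S → ℝ} {i : S} (h : ∀ k, M.parent k = some i → v k = w k) :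
    M.push v i = M.push w i := by
  simp only [push_apply]
  refine Finset.sum_congr rfl fun k _ => ?_
  by_cases hk : M.parent k = some i
  · rw [h k hk]
  · rw [M.P_eq_zero k i hk, zero_mul, zero_mul]

theorem push_le_push {v w : S → ℝ} {i : S} (h : ∀ k, M.parent k = some i → v k ≤ w k) :
    M.push v i ≤ M.push w i := by
  simp only [push_apply]
  refine Finset.sum_le_sum fun k _ => ?_
  by_cases hk : M.parent k = some i
  · exact mul_le_mul_of_nonneg_left (h k hk) (M.P_nonneg i k)
  · rw [M.P_eq_zero k i hk, zero_mul, zero_mul]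

theorem push_nonneg {w : S → ℝ} (h : ∀ k, 0 ≤ w k) (i : S) : 0 ≤ M.push w i := by
  rw [push_apply]
  exact Finset.sum_nonneg fun k _ => mul_nonneg (M.P_nonneg i k) (h k)

theorem minAbandonProb_le (i : S) : M.minAbandonProb ≤ M.abandonProb i :=
  Finset.inf'_le _ (Finset.mem_univ i)

theorem minAbandonProb_le_one : M.minAbandonProb ≤ 1 := by
  refine (M.minAbandonProb_le M.root).trans ?_
  have : 0 ≤ ∑ k ∈ M.child M.root, M.P M.root k :=
    Finset.sum_nonneg fun k _ => M.P_nonneg _ k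
  rw [abandonProb]
  linarith

theorem cost_le_maxCost (i : S) : M.cost i ≤ M.maxCost :=
  Finset.le_sup' _ (Finset.mem_univ i)

theorem maxCost_pos : 0 < M.maxCost := (M.cost_pos M.root).trans_le (M.cost_le_maxCost _)

theorem sum_P_le (i : S) : ∑ k, M.P i k ≤ 1 - M.minAbandonProb := by
  have := M.minAbandonProb_le i
  rw [abandonProb, sum_child] at this
  linarith

theorem push_le_of_le {w : S → ℝ} {c : ℝ} (hc : 0 ≤ c) {i : S}
    (h : ∀ k, M.parent k = some i → w k ≤ c) :
    M.push w i ≤ (1 - M.minAbandonProb) * c := by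
  refine (M.push_le_push (w := fun _ => c) h).trans ?_
  rw [push_apply, ← Finset.sum_mul]
  exact mul_le_mul_of_nonneg_right (M.sum_P_le i) hc

theorem push_le_one {w : S → ℝ} (h : ∀ k, w k ≤ 1) (i : S) : M.push w i ≤ 1 := by
  rw [push_apply]
  refine le_trans (Finset.sum_le_sum fun k _ => ?_) (M.sum_P_le_one i)
  exact mul_le_of_le_one_right (M.P_nonneg i k) (h k)

theorem push_pow_mem {w : S → ℝ} (h0 : ∀ k, 0 ≤ w k) (h1 : ∀ k, w k ≤ 1) (n : ℕ) :
    (∀ k, 0 ≤ (M.push ^ n) w k) ∧ ∀ k, (M.push ^ n) w k ≤ 1 := by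
  induction n with
  | zero => exact ⟨h0, h1⟩
  | succ n ih =>
    rw [pow_succ']
    exact ⟨M.push_nonneg ih.1, M.push_le_one ih.2⟩

/-- Each transition descends one level, so `P` is nilpotent; this makes all inductions over the age
of a job finite. -/
theorem push_pow_eq_zero (w : S → ℝ) (n : ℕ) (i : S) (h : M.numLevels ≤ M.level i + n) :
    (M.push ^ n) w i = 0 := by
  induction n generalizing i with
  | zero =>
    have := M.level_lt_numLevels i
    omega
  | succ n ih =>
    rw [pow_succ', Module.End.mul_apply]
    rw [M.push_congr (w := 0) fun k hk => ih k ?_]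
    · rw [map_zero, Pi.zero_apply]
    · have := M.level_of_parent k i hk
      omega

theorem push_pow_numLevels (w : S → ℝ) : (M.push ^ M.numLevels) w = 0 :=
  funext fun i => M.push_pow_eq_zero w _ i (by omega)

/-- Induction from the leaves to the root. -/
theorem child_induction {p : S → Prop} (h : ∀ i, (∀ k, M.parent k = some i → p k) → p i) (i : S) :
    p i := by
  induction hn : M.numLevels - M.level i using Nat.strong_induction_on generalizing i with
  | _ n ih =>
    refine h i fun k hk => ih _ ?_ k rfl
    have h1 := M.level_of_parent k i hk
    have h2 := M.level_lt_numLevels k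
    omega

/-! ### Hitting probabilities -/

open Classical in
/-- The probability that an unserved job in state `i` is in `A`, now or later. -/
noncomputable def hitProb (A : Set S) (i : S) : ℝ :=
  if i ∈ A then 1 else ∑ k : M.child i, M.P i k * hitProb A k
termination_by M.numLevels - M.level i
decreasing_by
  have hk : M.parent k = some i := by simpa [child] using k.2
  have h1 := M.level_of_parent _ _ hk
  have h2 := M.level_lt_numLevels k
  omega

/-- A job in state `i` has earlier been in `A`. -/
inductive Visited (A : Set S) : S → Prop
  | of_mem {i k : S} : M.parent k = some i → i ∈ A → Visited A k
  | of_visited {i k : S} : M.parent k = some i → Visited A i → Visited A k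

variable (A : Set S)

theorem hitProb_of_mem {A : Set S} {i : S} (h : i ∈ A) : M.hitProb A i = 1 := by
  rw [hitProb, if_pos h]

theorem hitProb_of_notMem {A : Set S} {i : S} (h : i ∉ A) :
    M.hitProb A i = M.push (M.hitProb A) i := by
  rw [hitProb, if_neg h, Finset.sum_coe_sort (M.child i) fun k => M.P i k * M.hitProb A k,
    sum_child_mul]

theorem hitProb_nonneg (i : S) : 0 ≤ M.hitProb A i := by
  induction i using M.child_induction with | h i ih => ?_
  by_cases h : i ∈ A
  · rw [M.hitProb_of_mem h]
    exact zero_le_one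
  · rw [M.hitProb_of_notMem h, ← Pi.zero_apply (M := fun _ : S => ℝ) i, ← map_zero M.push]
    exact M.push_le_push ih

theorem hitProb_le_one (i : S) : M.hitProb A i ≤ 1 := by
  induction i using M.child_induction with | h i ih => ?_
  by_cases h : i ∈ A
  · rw [M.hitProb_of_mem h]
  · rw [M.hitProb_of_notMem h]
    refine (M.push_le_push (w := fun _ => 1) ih).trans (M.push_le_one (fun _ => le_rfl) i)

theorem push_hitProb_le (i : S) : M.push (M.hitProb A) i ≤ 1 - M.minAbandonProb := by
  simpa using M.push_le_of_le zero_le_one (i := i) fun k _ => M.hitProb_le_one A k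

theorem visited_iff {A : Set S} {i k : S} (h : M.parent k = some i) :
    M.Visited A k ↔ i ∈ A ∨ M.Visited A i := by
  refine ⟨fun hv => ?_, fun hv => hv.elim (.of_mem h) (.of_visited h)⟩
  cases hv with
  | of_mem h' hi => exact .inl (by rwa [← Option.some.inj (h'.symm.trans h)])
  | of_visited h' hi => exact .inr (by rwa [← Option.some.inj (h'.symm.trans h)])

theorem not_visited_root : ¬ M.Visited A M.root := by
  have h := (M.parent_eq_none M.root).2 rfl
  intro hv
  cases hv with
  | of_mem h' _ => simp [h] at h'
  | of_visited h' _ => simp [h] at h'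

/-- The states of `A` without a proper ancestor in `A`. -/
def firstHit : Set S := {i | i ∈ A ∧ ¬ M.Visited A i}

/-- The states of `A` with a proper ancestor in `A`. -/
def laterHit : Set S := {i | i ∈ A ∧ M.Visited A i}

/-- The probability that a job in state `i` is in `A` for the first time, now or later. -/
noncomputable def firstHitProb : S → ℝ := {i | ¬ M.Visited A i}.indicator (M.hitProb A)

/-- The probability of hitting `A`, restricted to jobs that have earlier been in `A`. -/
noncomputable def laterHitProb : S → ℝ := {i | M.Visited A i}.indicator (M.hitProb A)

theorem firstHitProb_root : M.firstHitProb A M.root = M.hitProb A M.root := by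
  rw [firstHitProb, Set.indicator_of_mem]
  exact M.not_visited_root A

theorem laterHitProb_root : M.laterHitProb A M.root = 0 := by
  rw [laterHitProb, Set.indicator_of_notMem]
  exact M.not_visited_root A

theorem laterHitProb_nonneg (i : S) : 0 ≤ M.laterHitProb A i :=
  Set.indicator_nonneg (fun i _ => M.hitProb_nonneg A i) i

theorem push_firstHitProb_of_mem {A : Set S} {i : S} (h : i ∈ A ∨ M.Visited A i) :
    M.push (M.firstHitProb A) i = 0 := by
  rw [M.push_congr (w := 0), map_zero, Pi.zero_apply]
  intro k hk
  rw [firstHitProb, Set.indicator_of_notMem, Pi.zero_apply]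
  exact not_not.2 ((M.visited_iff hk).2 h)

theorem push_firstHitProb_of_notMem {A : Set S} {i : S} (h : ¬ (i ∈ A ∨ M.Visited A i)) :
    M.push (M.firstHitProb A) i = M.push (M.hitProb A) i := by
  refine M.push_congr fun k hk => ?_
  rw [firstHitProb, Set.indicator_of_mem]
  simpa [M.visited_iff hk] using h

/-- The Poisson equation of the first visit. On states that are in `A` or below it the transition
term vanishes, because their children count as visited. Iterating it counts expected first visits by
powers of `P`. -/
theorem firstHitProb_eq :
    M.firstHitProb A = (M.firstHit A).indicator 1 + M.push (M.firstHitProb A) := by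
  funext i
  rw [Pi.add_apply]
  by_cases hv : M.Visited A i
  · rw [M.push_firstHitProb_of_mem (.inr hv), firstHitProb,
      Set.indicator_of_notMem (by simpa using hv), Set.indicator_of_notMem, add_zero]
    exact fun h => h.2 hv
  · rw [firstHitProb, Set.indicator_of_mem (by simpa using hv), ← firstHitProb]
    by_cases hi : i ∈ A
    · rw [M.push_firstHitProb_of_mem (.inl hi), M.hitProb_of_mem hi, Set.indicator_of_mem]
      · simp
      · exact ⟨hi, hv⟩
    · rw [M.push_firstHitProb_of_notMem (by simp [hi, hv]), M.hitProb_of_notMem hi,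
        Set.indicator_of_notMem, zero_add]
      exact fun h => hi h.1

theorem sum_push_pow_firstHit (n : ℕ) :
    ∑ j ∈ Finset.range n, (M.push ^ j) ((M.firstHit A).indicator 1) =
      M.firstHitProb A - (M.push ^ n) (M.firstHitProb A) := by
  induction n with
  | zero => simp
  | succ n ih =>
    rw [Finset.sum_range_succ, ih, eq_sub_of_add_eq (M.firstHitProb_eq A).symm, map_sub,
      pow_succ, Module.End.mul_apply]
    abel

theorem sum_push_pow_firstHit_numLevels :
    ∑ j ∈ Finset.range M.numLevels, (M.push ^ j) ((M.firstHit A).indicator 1) =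
      M.firstHitProb A := by
  rw [sum_push_pow_firstHit, push_pow_numLevels, sub_zero]

/-- Identifies the fluid mean of the number of first visits, summed over the ages of jobs, with the
hitting probability in the first-order conditions. -/
theorem sum_push_pow_firstHit_root :
    ∑ j ∈ Finset.range M.numLevels, (M.push ^ j) ((M.firstHit A).indicator 1) M.root =
      M.hitProb A M.root := by
  rw [← Finset.sum_apply, sum_push_pow_firstHit_numLevels, firstHitProb_root]

/-- The first visits lost by serving a job: none if it is in `A`, since any later visit is not the
first; otherwise at most the survival probability of one transition. -/
theorem push_firstHitProb_le (i : S) :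
    M.push (M.firstHitProb A) i ≤ (1 - M.minAbandonProb) * Aᶜ.indicator 1 i := by
  have h1 := M.minAbandonProb_le_one
  by_cases hi : i ∈ A
  · rw [M.push_firstHitProb_of_mem (.inl hi), Set.indicator_of_notMem (by simpa using hi), mul_zero]
  · rw [Set.indicator_of_mem hi, Pi.one_apply, mul_one]
    by_cases hv : M.Visited A i
    · rw [M.push_firstHitProb_of_mem (.inr hv)]
      linarith
    · rw [M.push_firstHitProb_of_notMem (by simp [hi, hv])]
      exact M.push_hitProb_le A i

theorem laterHit_le_laterHitProb (i : S) :
    (M.laterHit A).indicator 1 i ≤ M.laterHitProb A i := by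
  by_cases hi : i ∈ M.laterHit A
  · rw [Set.indicator_of_mem hi, laterHitProb, Set.indicator_of_mem (by exact hi.2),
      M.hitProb_of_mem hi.1, Pi.one_apply]
  · rw [Set.indicator_of_notMem hi]
    exact M.laterHitProb_nonneg A i

/-- Drift inequality for the potential of future repeat visits: each repeat visit consumes one unit,
and new potential is created only by jobs left unserved in `A`, at most `1 - θ` each. -/
theorem push_laterHitProb_le (i : S) :
    M.push (M.laterHitProb A) i ≤ M.laterHitProb A i - (M.laterHit A).indicator 1 i +
      (1 - M.minAbandonProb) * A.indicator 1 i := by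
  by_cases hi : i ∈ A
  · have h1 := M.laterHit_le_laterHitProb A i
    have h2 : M.push (M.laterHitProb A) i ≤ 1 - M.minAbandonProb := by
      refine (M.push_le_push fun k _ => ?_).trans (M.push_hitProb_le A i)
      exact Set.indicator_le_self' (fun k _ => M.hitProb_nonneg A k) k
    rw [Set.indicator_of_mem hi, Pi.one_apply, mul_one]
    linarith
  · rw [Set.indicator_of_notMem hi, Set.indicator_of_notMem (fun h => hi h.1), sub_zero, mul_zero,
      add_zero]
    by_cases hv : M.Visited A i
    · rw [laterHitProb, Set.indicator_of_mem (by exact hv), M.hitProb_of_notMem hi]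
      refine (M.push_le_push fun k _ => ?_)
      exact Set.indicator_le_self' (fun k _ => M.hitProb_nonneg A k) k
    · rw [M.push_congr (w := 0), map_zero, Pi.zero_apply]
      · exact M.laterHitProb_nonneg A i
      · intro k hk
        rw [laterHitProb, Set.indicator_of_notMem, Pi.zero_apply]
        simp [M.visited_iff hk, hi, hv]

theorem indicator_eq_firstHit_add (i : S) :
    A.indicator (1 : S → ℝ) i =
      (M.firstHit A).indicator 1 i + (M.laterHit A).indicator 1 i := by
  classical
  by_cases hi : i ∈ A <;> by_cases hv : M.Visited A i <;>
    simp [firstHit, laterHit, hi, hv]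

/-! ### The ski-rental problem -/

theorem index_eq (γ : ℝ) (i : S) : M.index γ i = M.cost i + M.push (M.costToGo γ) i := by
  rw [index, futureCostToGo, sum_child_mul]

theorem costToGo_eq_min (γ : ℝ) (i : S) : M.costToGo γ i = min γ (M.index γ i) :=
  M.costToGo_eq γ i

theorem costToGo_le (γ : ℝ) (i : S) : M.costToGo γ i ≤ γ :=
  (M.costToGo_eq_min γ i).trans_le (min_le_left _ _)

theorem costToGo_le_index (γ : ℝ) (i : S) : M.costToGo γ i ≤ M.index γ i :=
  (M.costToGo_eq_min γ i).trans_le (min_le_right _ _)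

theorem costToGo_nonneg {γ : ℝ} (hγ : 0 ≤ γ) (i : S) : 0 ≤ M.costToGo γ i := by
  induction i using M.child_induction with | h i ih => ?_
  rw [costToGo_eq_min, index_eq]
  refine le_min hγ (add_nonneg (M.cost_pos i).le ?_)
  rw [← Pi.zero_apply (M := fun _ : S => ℝ) i, ← map_zero M.push]
  exact M.push_le_push ih

/-- A job survives each transition with probability at most `1 - θ`, so expected remaining costs are
dominated by a geometric series. -/
theorem index_le (hθ : 0 < M.minAbandonProb) (γ : ℝ) (i : S) :
    M.index γ i ≤ M.maxCost / M.minAbandonProb := by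
  induction i using M.child_induction with | h i ih => ?_
  have h0 : 0 ≤ M.maxCost / M.minAbandonProb := div_nonneg M.maxCost_pos.le hθ.le
  have h1 := M.push_le_of_le h0 (i := i) fun k hk => (M.costToGo_le_index γ k).trans (ih k hk)
  rw [index_eq]
  have h2 : (1 - M.minAbandonProb) * (M.maxCost / M.minAbandonProb) =
      M.maxCost / M.minAbandonProb - M.maxCost := by
    field_simp
  have h3 := M.cost_le_maxCost i
  linarith

theorem continuous_costToGo (i : S) : Continuous fun γ => M.costToGo γ i := by
  induction i using M.child_induction with | h i ih => ?_
  have h : (fun γ => M.costToGo γ i) =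
      fun γ => min γ (M.cost i + ∑ k ∈ M.child i, M.P i k * M.costToGo γ k) :=
    funext fun γ => M.costToGo_eq γ i
  rw [h]
  refine continuous_id.min (continuous_const.add (continuous_finsetSum _ fun k hk => ?_))
  exact continuous_const.mul (ih k (by simpa [child] using hk))

theorem costToGo_mono {γ γ' : ℝ} (h : γ ≤ γ') (i : S) : M.costToGo γ i ≤ M.costToGo γ' i := by
  induction i using M.child_induction with | h i ih => ?_
  rw [costToGo_eq_min, costToGo_eq_min, index_eq, index_eq]
  exact min_le_min h (add_le_add le_rfl (M.push_le_push ih))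

/-- Above the largest index, the cost-to-go does not depend on the price. -/
theorem costToGo_eq_of_le (hθ : 0 < M.minAbandonProb) {γ γ' : ℝ}
    (h : M.maxCost / M.minAbandonProb ≤ γ) (h' : M.maxCost / M.minAbandonProb ≤ γ') (i : S) :
    M.costToGo γ i = M.costToGo γ' i := by
  induction i using M.child_induction with | h i ih => ?_
  rw [costToGo_eq_min, costToGo_eq_min, min_eq_right ((M.index_le hθ γ i).trans h),
    min_eq_right ((M.index_le hθ γ' i).trans h'), index_eq, index_eq, M.push_congr ih]

/-- The states whose index exceeds the price. -/
def above (γ : ℝ) : Set S := {i | γ < M.index γ i}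

/-- The states whose index is at least the price. -/
def atLeast (γ : ℝ) : Set S := {i | γ ≤ M.index γ i}

/-- A lower bound for the right derivative of the cost-to-go. -/
theorem le_costToGo_add {γ δ : ℝ} (hδ : 0 ≤ δ) (h : ∀ i ∈ M.above γ, γ + δ ≤ M.index γ i) (i : S) :
    M.costToGo γ i + δ * M.hitProb (M.above γ) i ≤ M.costToGo (γ + δ) i := by
  induction i using M.child_induction with | h i ih => ?_
  rw [M.costToGo_eq_min (γ + δ) i]
  by_cases hi : i ∈ M.above γ
  · rw [M.hitProb_of_mem hi, mul_one]
    have h1 := M.costToGo_le γ i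
    have h2 : M.index γ i ≤ M.index (γ + δ) i := by
      rw [index_eq, index_eq]
      exact add_le_add le_rfl (M.push_le_push fun k _ => M.costToGo_mono (by linarith) k)
    have h3 := h i hi
    exact le_min (by linarith) (by linarith)
  · refine le_min ?_ ?_
    · have h1 := M.costToGo_le γ i
      have h2 := mul_le_of_le_one_right hδ (M.hitProb_le_one (M.above γ) i)
      linarith
    · have h1 := M.push_le_push ih
      have h2 := M.costToGo_le_index γ i
      have h3 : M.push (fun k => M.costToGo γ k + δ * M.hitProb (M.above γ) k) i =
          M.push (M.costToGo γ) i + δ * M.push (M.hitProb (M.above γ)) i := by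
        rw [show (fun k => M.costToGo γ k + δ * M.hitProb (M.above γ) k) =
          M.costToGo γ + δ • M.hitProb (M.above γ) from rfl, map_add, map_smul]
        rfl
      rw [M.hitProb_of_notMem hi]
      rw [index_eq] at h2 ⊢
      linarith

/-- An upper bound for the left derivative of the cost-to-go. -/
theorem costToGo_sub_le {γ δ : ℝ} (hδ : 0 ≤ δ) (h : ∀ i ∉ M.atLeast γ, M.index γ i + δ ≤ γ)
    (i : S) :
    M.costToGo γ i - δ * M.hitProb (M.atLeast γ) i ≤ M.costToGo (γ - δ) i := by
  induction i using M.child_induction with | h i ih => ?_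
  rw [M.costToGo_eq_min (γ - δ) i]
  have h1 := M.push_le_push ih
  have h2 := M.costToGo_le_index γ i
  have h3 : M.push (fun k => M.costToGo γ k - δ * M.hitProb (M.atLeast γ) k) i =
      M.push (M.costToGo γ) i - δ * M.push (M.hitProb (M.atLeast γ)) i := by
    rw [show (fun k => M.costToGo γ k - δ * M.hitProb (M.atLeast γ) k) =
      M.costToGo γ - δ • M.hitProb (M.atLeast γ) from rfl, map_sub, map_smul]
    rfl
  by_cases hi : i ∈ M.atLeast γ
  · rw [M.hitProb_of_mem hi, mul_one]
    have h4 := M.costToGo_le γ i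
    refine le_min (by linarith) ?_
    have h5 := mul_le_of_le_one_right hδ
      (M.push_le_one (M.hitProb_le_one (M.atLeast γ)) i)
    rw [index_eq] at h2 ⊢
    linarith
  -- Below the price, the gap of at least `δ` keeps the old value below the reduced price; only the
  -- Bellman branch of the minimum needs the induction hypothesis.
  · have h4 := h i hi
    have h5 := mul_nonneg hδ (M.hitProb_nonneg (M.atLeast γ) i)
    refine le_min (by linarith) ?_
    rw [M.hitProb_of_notMem hi]
    rw [index_eq] at h2 ⊢
    linarith

end TreeChain

/-- A positive lower bound for finitely many positive numbers. -/
theorem exists_pos_le_of_finite {ι : Type*} [Finite ι] (s : Set ι) (f : ι → ℝ)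
    (h : ∀ i ∈ s, 0 < f i) : ∃ δ, 0 < δ ∧ ∀ i ∈ s, δ ≤ f i := by
  classical
  have := Fintype.ofFinite ι
  by_cases hs : (s.toFinset).Nonempty
  · obtain ⟨i, hi, hmin⟩ := Finset.exists_min_image s.toFinset f hs
    exact ⟨f i, h i (by simpa using hi), fun k hk => hmin k (by simpa using hk)⟩
  · refine ⟨1, one_pos, fun i hi => absurd ⟨i, by simpa using hi⟩ hs⟩

/-! ### First-order conditions for the capacity price -/

namespace Model

variable {S : Type*} [Fintype S] [DecidableEq S] (M : Model S)

/-- The objective is continuous, and beyond `c_max / θ` the cost-to-go is constant, so a minimizer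
over a compact interval is global. -/
theorem exists_isCapacityPrice (hθ : 0 < M.minAbandonProb) : ∃ γ, M.IsCapacityPrice γ := by
  set B := M.maxCost / M.minAbandonProb with hB
  have hB0 : 0 ≤ B := div_nonneg M.maxCost_pos.le hθ.le
  set F : ℝ → ℝ := fun x => (M.serviceRate : ℝ) * x - M.arrivalRate * M.costToGo x M.root with hF
  have hcont : Continuous F :=
    (continuous_const.mul continuous_id).sub
      (continuous_const.mul (M.continuous_costToGo M.root))
  obtain ⟨γ, hγ, hmin⟩ := isCompact_Icc.exists_isMinOn (Set.nonempty_Icc.2 hB0) hcont.continuousOn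
  refine ⟨γ, hγ.1, fun x hx => ?_⟩
  rcases le_total x B with h | h
  · exact hmin ⟨hx, h⟩
  · have h1 : F γ ≤ F B := hmin ⟨hB0, le_rfl⟩
    have h2 : F B ≤ F x := by
      simp only [hF]
      rw [M.costToGo_eq_of_le hθ le_rfl h]
      have := mul_le_mul_of_nonneg_left h M.serviceRate.2.1
      linarith
    exact h1.trans h2

variable {M} {γ : ℝ}

/-- Beyond `c_max / θ` the objective has slope `μ > 0`. The bound puts both defects of the algorithm
on the same scale. -/
theorem IsCapacityPrice.le (h : M.IsCapacityPrice γ) (hθ : 0 < M.minAbandonProb) :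
    γ ≤ M.maxCost / M.minAbandonProb := by
  by_contra! hlt
  have hB0 : 0 ≤ M.maxCost / M.minAbandonProb := div_nonneg M.maxCost_pos.le hθ.le
  have h1 := h.2 (Set.mem_Ici.2 hB0)
  simp only [Set.mem_ofPred_eq] at h1
  rw [M.costToGo_eq_of_le hθ le_rfl hlt.le] at h1
  have hμ : (0 : ℝ) < M.serviceRate := M.serviceRate_pos
  have := mul_lt_mul_of_pos_left hlt hμ
  linarith

/-- At an optimal price, servers suffice for the jobs reaching a state with index above it. -/
theorem IsCapacityPrice.arrivalRate_mul_hitProb_le (h : M.IsCapacityPrice γ) :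
    (M.arrivalRate : ℝ) * M.hitProb (M.above γ) M.root ≤ M.serviceRate := by
  obtain ⟨δ, hδ, hle⟩ := exists_pos_le_of_finite (M.above γ) (fun i => M.index γ i - γ)
    fun i hi => sub_pos.2 hi
  have h1 := M.le_costToGo_add hδ.le (fun i hi => by have := hle i hi; linarith) M.root
  have h2 := h.2 (show γ + δ ∈ Set.Ici (0 : ℝ) from add_nonneg h.1 hδ.le)
  simp only [Set.mem_ofPred_eq] at h2
  have h3 := mul_le_mul_of_nonneg_left h1 M.arrivalRate.2.1
  have h4 : δ * ((M.arrivalRate : ℝ) * M.hitProb (M.above γ) M.root) ≤ δ * M.serviceRate := by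
    linarith
  exact le_of_mul_le_mul_left h4 hδ

/-- At a positive optimal price, the jobs reaching a state with index at least the price suffice
to occupy all servers. -/
theorem IsCapacityPrice.serviceRate_le (h : M.IsCapacityPrice γ) (hγ : 0 < γ) :
    (M.serviceRate : ℝ) ≤ M.arrivalRate * M.hitProb (M.atLeast γ) M.root := by
  obtain ⟨ε, hε, hle⟩ := exists_pos_le_of_finite (M.atLeast γ)ᶜ (fun i => γ - M.index γ i)
    fun i hi => sub_pos.2 (not_le.1 hi)
  -- Truncating at `γ` keeps the competing price `γ - δ` nonnegative; this is where `γ > 0` enters.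
  set δ := min ε γ with hδ
  have hδ0 : 0 < δ := lt_min hε hγ
  have h1 := M.costToGo_sub_le hδ0.le (fun i hi => by
    have := hle i hi
    have := min_le_left ε γ
    linarith) M.root
  have h2 := h.2 (show γ - δ ∈ Set.Ici (0 : ℝ) from
    Set.mem_Ici.2 (sub_nonneg.2 (min_le_right _ _)))
  simp only [Set.mem_ofPred_eq] at h2
  have h3 := mul_le_mul_of_nonneg_left h1 M.arrivalRate.2.1
  have h4 : δ * (M.serviceRate : ℝ) ≤ δ * (M.arrivalRate * M.hitProb (M.atLeast γ) M.root) := by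
    linarith
  exact le_of_mul_le_mul_left h4 hδ0

end Model

end UncertainCostQueue

namespace UncertainCostQueue

/-! ### Weighted numbers of jobs -/

namespace Queue

variable {S : Type*} (q : Queue S) (s : Finset Job) (w : S → ℝ)

/-- The total weight of the waiting jobs. -/
noncomputable def total : ℝ := ∑ j : q.jobs, w (q.state j)

/-- The total weight of the waiting jobs that are not served. -/
noncomputable def unserved : ℝ := ∑ j : q.jobs, if (j : Job) ∈ s then 0 else w (q.state j)

/-- The total weight of the waiting jobs that are served. -/
noncomputable def served : ℝ := ∑ j : q.jobs, if (j : Job) ∈ s then w (q.state j) else 0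

theorem served_add_unserved : q.served s w + q.unserved s w = q.total w := by
  rw [served, unserved, total, ← Finset.sum_add_distrib]
  refine Finset.sum_congr rfl fun j _ => ?_
  split_ifs <;> simp

variable {q s w} in
theorem unserved_mono {v : S → ℝ} (h : ∀ i, v i ≤ w i) : q.unserved s v ≤ q.unserved s w := by
  refine Finset.sum_le_sum fun j _ => ?_
  split_ifs
  · exact le_rfl
  · exact h _

variable {q s w} in
theorem served_mono {v : S → ℝ} (h : ∀ i, v i ≤ w i) : q.served s v ≤ q.served s w := by
  refine Finset.sum_le_sum fun j _ => ?_
  split_ifs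
  · exact h _
  · exact le_rfl

theorem unserved_add (v : S → ℝ) :
    q.unserved s (fun i => v i + w i) = q.unserved s v + q.unserved s w := by
  rw [unserved, unserved, unserved, ← Finset.sum_add_distrib]
  refine Finset.sum_congr rfl fun j _ => ?_
  split_ifs <;> simp

theorem unserved_const_mul (c : ℝ) : q.unserved s (fun i => c * w i) = c * q.unserved s w := by
  rw [unserved, unserved, Finset.mul_sum]
  refine Finset.sum_congr rfl fun j _ => ?_
  split_ifs <;> simp

theorem served_add (v : S → ℝ) :
    q.served s (fun i => v i + w i) = q.served s v + q.served s w := by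
  rw [served, served, served, ← Finset.sum_add_distrib]
  refine Finset.sum_congr rfl fun j _ => ?_
  split_ifs <;> simp

theorem served_const_mul (c : ℝ) : q.served s (fun i => c * w i) = c * q.served s w := by
  rw [served, served, Finset.mul_sum]
  refine Finset.sum_congr rfl fun j _ => ?_
  split_ifs <;> simp

theorem total_add (v : S → ℝ) : q.total (fun i => v i + w i) = q.total v + q.total w :=
  Finset.sum_add_distrib

theorem total_sub (v : S → ℝ) : q.total (fun i => v i - w i) = q.total v - q.total w :=
  Finset.sum_sub_distrib _ _

theorem total_const_mul (c : ℝ) : q.total (fun i => c * w i) = c * q.total w :=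
  (Finset.mul_sum _ _ _).symm

variable {w} in
theorem total_mono {v : S → ℝ} (h : ∀ i, v i ≤ w i) : q.total v ≤ q.total w :=
  Finset.sum_le_sum fun _ _ => h _

variable {w} in
theorem total_nonneg (h : ∀ i, 0 ≤ w i) : 0 ≤ q.total w := Finset.sum_nonneg fun _ _ => h _

variable {w} in
theorem served_nonneg (h : ∀ i, 0 ≤ w i) : 0 ≤ q.served s w :=
  Finset.sum_nonneg fun j _ => by
    split_ifs
    · exact h _
    · exact le_rfl

variable {w} in
theorem unserved_nonneg (h : ∀ i, 0 ≤ w i) : 0 ≤ q.unserved s w :=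
  Finset.sum_nonneg fun j _ => by
    split_ifs
    · exact le_rfl
    · exact h _

theorem total_one : q.total 1 = q.jobs.card := by
  simp [total]

variable {s} in
theorem served_one (h : s ⊆ q.jobs) : q.served s 1 = s.card := by
  have h1 : q.served s 1 = ∑ j ∈ q.jobs, if j ∈ s then (1 : ℝ) else 0 :=
    Finset.sum_coe_sort q.jobs fun j => if j ∈ s then (1 : ℝ) else 0
  rw [h1, Finset.sum_ite_mem, Finset.inter_eq_right.2 h]
  simp

theorem unserved_eq_sum_sdiff :
    q.unserved s w = ∑ j : ↥(q.jobs \ s), w (q.state ⟨j, (Finset.mem_sdiff.1 j.2).1⟩) := by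
  classical
  set g : Job → ℝ := fun j => if h : j ∈ q.jobs then w (q.state ⟨j, h⟩) else 0 with hg
  have h1 : q.unserved s w = ∑ j ∈ q.jobs, if j ∈ s then 0 else g j := by
    rw [← Finset.sum_coe_sort]
    refine Finset.sum_congr rfl fun j _ => ?_
    simp [hg]
  have h2 : ∑ j : ↥(q.jobs \ s), w (q.state ⟨j, (Finset.mem_sdiff.1 j.2).1⟩) =
      ∑ j ∈ q.jobs \ s, g j := by
    rw [← Finset.sum_coe_sort (q.jobs \ s) g]
    refine Finset.sum_congr rfl fun j _ => ?_
    simp [hg, (Finset.mem_sdiff.1 j.2).1]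
  rw [h1, h2, Finset.sdiff_eq_filter, Finset.sum_filter]
  refine Finset.sum_congr rfl fun j _ => ?_
  by_cases hj : j ∈ s <;> simp [hj]

end Queue

/-! ### One period -/

theorem TreeChain.expect_next {S : Type*} [Fintype S] [DecidableEq S] (M : TreeChain S) (i : S)
    (w : S → ℝ) : (M.next i).expect (fun o => o.elim 0 w) = M.push w i := by
  rw [PMF.expect_eq_sum (t := Finset.univ) (by simp), Fintype.sum_option, TreeChain.push_apply]
  simp [TreeChain.next, ENNReal.toReal_ofReal (M.P_nonneg i _)]

instance FeasiblePolicy.finitelySupported_select {S : Type*} (π : FeasiblePolicy S)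
    (past : List (Record S)) (r : ℕ) (q : Queue S) : (π.select past r q).FinitelySupported :=
  ⟨(Finset.finite_toSet q.jobs.powerset).subset fun s hs => by
    simpa using π.subset_jobs past r q s hs⟩

namespace Model

variable {S : Type*} [Fintype S] [DecidableEq S] (M : Model S)

instance (N : ℕ) : (M.capacityLaw N).FinitelySupported := by
  unfold capacityLaw
  infer_instance

instance (N : ℕ) : (M.arrivalLaw N).FinitelySupported := by
  unfold arrivalLaw
  infer_instance

instance (N : ℕ) (π : FeasiblePolicy S) (x : List (Record S) × Queue S) :
    (M.step N π x).FinitelySupported := by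
  unfold step
  infer_instance

instance finitelySupported_law (N : ℕ) (π : FeasiblePolicy S) (T : ℕ) :
    (M.law N π T).FinitelySupported := by
  induction T with
  | zero =>
    unfold law
    infer_instance
  | succ T ih =>
    unfold law
    infer_instance

/-- The condition on arrival periods makes the identities of new jobs fresh; otherwise the union of
survivors and arrivals could overlap. -/
theorem total_nextQueue (q : Queue S) (s : Finset Job) (f : ↥(q.jobs \ s) → Option S) {t : ℕ}
    (ht : ∀ j ∈ q.jobs, j.1 < t) (n : ℕ) (w : S → ℝ) :
    (M.nextQueue q s f (newJobs t n)).total w =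
      ∑ j, (f j).elim 0 w + n * w M.root := by
  classical
  set g : Job → ℝ := fun j =>
    w (if h : j ∈ q.jobs \ s then (f ⟨j, h⟩).getD M.root else M.root) with hg
  have h1 : (M.nextQueue q s f (newJobs t n)).total w =
      ∑ j ∈ (M.nextQueue q s f (newJobs t n)).jobs, g j :=
    Finset.sum_coe_sort (M.nextQueue q s f (newJobs t n)).jobs g
  have hnew : ∀ j ∈ newJobs t n, j ∉ q.jobs := by
    intro j hj hq
    obtain ⟨a, _, rfl⟩ := Finset.mem_image.1 hj
    exact lt_irrefl _ (ht _ hq)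
  rw [h1, nextQueue]
  dsimp only
  rw [Finset.sum_union, Finset.sum_map, Finset.sum_filter]
  · congr 1
    · refine Finset.sum_congr rfl fun j _ => ?_
      have hj : (j : Job) ∈ q.jobs \ s := j.2
      simp only [hg, Function.Embedding.subtype_apply, dif_pos hj, Subtype.coe_eta]
      cases f j <;> simp
    · rw [Finset.sum_congr rfl (g := fun _ => w M.root)]
      · rw [Finset.sum_const, newJobs, Finset.card_image_of_injective _ (Prod.mk_right_injective t),
          Finset.card_range, nsmul_eq_mul]
      · intro j hj
        have h2 : j ∉ q.jobs \ s := fun h => hnew j hj (Finset.mem_sdiff.1 h).1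
        simp only [hg, dif_neg h2]
  · rw [Finset.disjoint_left]
    intro j hj hj'
    obtain ⟨a, _, rfl⟩ := Finset.mem_map.1 hj
    exact hnew _ hj' (Finset.mem_sdiff.1 a.2).1

instance (q : Queue S) (s : Finset Job) : (M.transitionLaw q s).FinitelySupported :=
  inferInstance

theorem expect_transitionLaw (q : Queue S) (s : Finset Job) (w : S → ℝ) :
    (M.transitionLaw q s).expect (fun f => ∑ j, (f j).elim 0 w) = q.unserved s (M.push w) := by
  rw [q.unserved_eq_sum_sdiff]
  refine (expect_independentLaw_sum _ fun (_ : ↥(q.jobs \ s)) (o : Option S) =>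
    o.elim 0 w).trans ?_
  exact Finset.sum_congr rfl fun j _ => M.expect_next _ w

theorem expect_transitionLaw_sq_le (q : Queue S) (s : Finset Job) {w : S → ℝ}
    (h0 : ∀ i, 0 ≤ w i) (h1 : ∀ i, w i ≤ 1) :
    (M.transitionLaw q s).expect
      (fun f => (∑ j, (f j).elim 0 w - q.unserved s (M.push w)) ^ 2) ≤ q.total 1 := by
  have key := expect_independentLaw_sq_le
    (fun j : ↥(q.jobs \ s) => M.next (q.state ⟨j, (Finset.mem_sdiff.1 j.2).1⟩))
    (fun _ o => o.elim 0 w) (fun _ o => by cases o <;> simp [h0])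
    (fun _ o => by cases o <;> simp [h1])
  rw [q.unserved_eq_sum_sdiff]
  simp only [M.expect_next, Finset.sum_sub_distrib] at key
  refine key.trans ?_
  rw [q.total_one, Fintype.card_coe]
  exact_mod_cast Finset.card_le_card Finset.sdiff_subset

/-! ### Means along the history and their one-period evolution -/

variable (N : ℕ) (π : FeasiblePolicy S)

/-- The joint law of the history before period `T + 1`, the capacity in that period, and the set
of jobs served. -/
noncomputable def periodLaw (T : ℕ) : PMF ((List (Record S) × Queue S) × ℕ × Finset Job) :=
  (M.law N π T).bind fun x => (M.capacityLaw N).bind fun r =>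
    (π.select x.1 r x.2).map fun s => (x, r, s)

instance (T : ℕ) : (M.periodLaw N π T).FinitelySupported := by
  unfold periodLaw
  infer_instance

/-- The expectation of a function of history, capacity and selection in period `T + 1`. -/
noncomputable def mean (T : ℕ) (F : Queue S → ℕ → Finset Job → ℝ) : ℝ :=
  (M.periodLaw N π T).expect fun ω => F ω.1.2 ω.2.1 ω.2.2

theorem mean_queue (T : ℕ) (F : Queue S → ℝ) :
    M.mean N π T (fun q _ _ => F q) = (M.law N π T).expect fun x => F x.2 := by
  simp only [mean, periodLaw, PMF.expect_bind, PMF.expect_map, PMF.expect_const]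

theorem mean_capacity (T : ℕ) (F : ℕ → ℝ) :
    M.mean N π T (fun _ r _ => F r) = (M.capacityLaw N).expect F := by
  simp only [mean, periodLaw, PMF.expect_bind, PMF.expect_map, PMF.expect_const]

theorem expect_law_succ (T : ℕ) (F : List (Record S) × Queue S → ℝ) :
    (M.law N π (T + 1)).expect F = (M.periodLaw N π T).expect fun ω =>
      (M.transitionLaw ω.1.2 ω.2.2).expect fun f => (M.arrivalLaw N).expect fun n =>
        F (⟨ω.2.1, ω.1.2, ω.2.2, newJobs (ω.1.1.length + 1) n⟩ :: ω.1.1,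
          M.nextQueue ω.1.2 ω.2.2 f (newJobs (ω.1.1.length + 1) n)) := by
  simp only [law, step, periodLaw, PMF.expect_bind, PMF.expect_map]

/-- Provides the freshness of identities needed in `total_nextQueue`. -/
theorem of_mem_support_law (T : ℕ) {x : List (Record S) × Queue S}
    (hx : x ∈ (M.law N π T).support) : x.1.length = T ∧ ∀ j ∈ x.2.jobs, j.1 ≤ T := by
  induction T generalizing x with
  | zero =>
    rw [law, PMF.mem_support_pure_iff] at hx
    simp [hx]
  | succ T ih =>
    rw [law, PMF.mem_support_bind_iff] at hx
    obtain ⟨y, hy, hx⟩ := hx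
    obtain ⟨hl, hj⟩ := ih hy
    simp only [step, PMF.mem_support_bind_iff, PMF.mem_support_map_iff] at hx
    obtain ⟨r, _, s, _, f, _, n, _, rfl⟩ := hx
    refine ⟨by simp [hl], fun j hjm => ?_⟩
    simp only [nextQueue, Finset.mem_union, Finset.mem_map] at hjm
    rcases hjm with ⟨a, _, rfl⟩ | hjm
    · have := hj _ (Finset.mem_sdiff.1 a.2).1
      simp only [Function.Embedding.subtype_apply]
      omega
    · obtain ⟨a, _, rfl⟩ := Finset.mem_image.1 hjm
      exact hl.le.trans_eq' rfl |> Nat.succ_le_succ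

theorem of_mem_support_periodLaw (T : ℕ) {ω : (List (Record S) × Queue S) × ℕ × Finset Job}
    (hω : ω ∈ (M.periodLaw N π T).support) :
    ω.1 ∈ (M.law N π T).support ∧ ω.2.2 ∈ (π.select ω.1.1 ω.2.1 ω.1.2).support := by
  simp only [periodLaw, PMF.mem_support_bind_iff, PMF.mem_support_map_iff] at hω
  obtain ⟨x, hx, r, _, s, hs, rfl⟩ := hω
  exact ⟨hx, hs⟩

variable {N π}

theorem mean_mono {T : ℕ} {F G : Queue S → ℕ → Finset Job → ℝ}
    (h : ∀ past r q, ∀ s ∈ (π.select past r q).support, F q r s ≤ G q r s) :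
    M.mean N π T F ≤ M.mean N π T G :=
  PMF.expect_mono fun ω hω => h ω.1.1 _ _ _ (M.of_mem_support_periodLaw N π T hω).2

theorem mean_add (T : ℕ) (F G : Queue S → ℕ → Finset Job → ℝ) :
    M.mean N π T (fun q r s => F q r s + G q r s) = M.mean N π T F + M.mean N π T G :=
  PMF.expect_add _ _ _

theorem mean_sub (T : ℕ) (F G : Queue S → ℕ → Finset Job → ℝ) :
    M.mean N π T (fun q r s => F q r s - G q r s) = M.mean N π T F - M.mean N π T G :=
  PMF.expect_sub _ _ _

theorem mean_const_mul (T : ℕ) (c : ℝ) (F : Queue S → ℕ → Finset Job → ℝ) :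
    M.mean N π T (fun q r s => c * F q r s) = c * M.mean N π T F :=
  PMF.expect_const_mul _ _ _

theorem mean_const (T : ℕ) (c : ℝ) : M.mean N π T (fun _ _ _ => c) = c :=
  PMF.expect_const _ _

variable (N π)

theorem mean_total_zero (F : ℝ → ℝ) (w : S → ℝ) :
    M.mean N π 0 (fun q _ _ => F (q.total w)) = F 0 := by
  rw [mean_queue _ _ _ _ fun q => F (q.total w), law, PMF.expect_pure]
  simp [Queue.total]

/-- The basic evolution equation behind all drift arguments: `w` is pulled back by `P` over the
unserved jobs, and arrivals contribute their mean at the root. -/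
theorem mean_total_succ (T : ℕ) (w : S → ℝ) :
    M.mean N π (T + 1) (fun q _ _ => q.total w) =
      M.mean N π T (fun q _ s => q.unserved s (M.push w)) + N * M.arrivalRate * w M.root := by
  rw [mean_queue _ _ _ _ fun q => q.total w, expect_law_succ, ← M.mean_const (N := N) (π := π) T
    (N * M.arrivalRate * w M.root), ← mean_add]
  refine PMF.expect_congr fun ω hω => ?_
  obtain ⟨hlen, hjobs⟩ := M.of_mem_support_law N π T (M.of_mem_support_periodLaw N π T hω).1
  have ht : ∀ j ∈ ω.1.2.jobs, j.1 < ω.1.1.length + 1 := fun j hj => by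
    have := hjobs j hj
    omega
  have hn : (M.arrivalLaw N).expect (fun n => (n : ℝ) * w M.root) =
      N * M.arrivalRate * w M.root := by
    simp only [mul_comm _ (w M.root)]
    rw [PMF.expect_const_mul, arrivalLaw, expect_binomial_id]
  simp only [M.total_nextQueue _ _ _ ht]
  simp only [PMF.expect_add, PMF.expect_const, hn, expect_transitionLaw]

/-- The number of waiting jobs in each level is at most `N` on average. -/
theorem mean_total_level_le (T l : ℕ) :
    M.mean N π T (fun q _ _ => q.total ({i | M.level i = l}.indicator 1)) ≤ N := by
  induction T generalizing l with
  | zero =>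
    rw [mean_total_zero _ _ _ fun x => x]
    positivity
  | succ T ih =>
    rw [mean_total_succ]
    cases l with
    | zero =>
      have h0 : M.push ({i | M.level i = 0}.indicator 1) = 0 := by
        funext i
        rw [M.push_congr (w := 0), map_zero]
        intro k hk
        rw [Set.indicator_of_notMem, Pi.zero_apply]
        have := M.level_of_parent k i hk
        simp [this]
      simp only [h0, Queue.unserved, Pi.zero_apply, ite_self, Finset.sum_const_zero, mean_const,
        zero_add]
      rw [Set.indicator_of_mem (by simp [M.level_eq_zero]), Pi.one_apply, mul_one]
      exact mul_le_of_le_one_right (Nat.cast_nonneg N) M.arrivalRate.2.2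
    | succ l =>
      have hroot : M.root ∉ {i | M.level i = l + 1} := by
        have := (M.level_eq_zero M.root).2 rfl
        simp [this]
      rw [Set.indicator_of_notMem hroot, mul_zero, add_zero]
      -- Jobs in level `l + 1` were in level `l` one period earlier; service and abandonment only
      -- reduce their number.
      refine le_trans (M.mean_mono fun past r q s hs => ?_) (ih l)
      rw [← q.served_add_unserved s]
      have h0 : ∀ i, 0 ≤ ({i | M.level i = l}.indicator 1 : S → ℝ) i := fun i =>
        Set.indicator_nonneg (fun _ _ => zero_le_one) i
      refine le_add_of_nonneg_of_le (q.served_nonneg s h0) (Queue.unserved_mono fun i => ?_)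
      by_cases hi : M.level i = l
      · rw [Set.indicator_of_mem (by exact hi), Pi.one_apply]
        exact M.push_le_one (fun k => Set.indicator_le_self' (fun _ _ => zero_le_one) k) i
      · rw [M.push_congr (w := 0), map_zero, Pi.zero_apply]
        · exact h0 i
        · intro k hk
          rw [Set.indicator_of_notMem, Pi.zero_apply]
          have := M.level_of_parent k i hk
          simp [this, hi]

theorem mean_total_one_le (T : ℕ) :
    M.mean N π T (fun q _ _ => q.total 1) ≤ N * M.numLevels := by
  have h : ∀ q : Queue S, q.total 1 =
      ∑ l ∈ Finset.range M.numLevels, q.total ({i | M.level i = l}.indicator 1) := by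
    intro q
    simp only [Queue.total]
    rw [Finset.sum_comm]
    refine Finset.sum_congr rfl fun j _ => ?_
    rw [Finset.sum_eq_single (M.level (q.state j))]
    · simp
    · intro l _ hl
      simp [hl.symm]
    · intro hl
      exact absurd (Finset.mem_range.2 (M.level_lt_numLevels _)) hl
  simp only [h]
  rw [mean, PMF.expect_finset_sum]
  calc _ ≤ ∑ _l ∈ Finset.range M.numLevels, (N : ℝ) :=
        Finset.sum_le_sum fun l _ => M.mean_total_level_le N π T l
    _ = N * M.numLevels := by simp [mul_comm]

/-- The mean of a `1`-Lipschitz function of a weighted number of jobs changes by at most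
`2 √(N L)` if transitions and arrivals are replaced by their conditional means. -/
theorem mean_lipschitz_total_succ_le (hN : 1 ≤ N) (T : ℕ) {w : S → ℝ} (h0 : ∀ i, 0 ≤ w i)
    (h1 : ∀ i, w i ≤ 1) {g : ℝ → ℝ} (hg : ∀ a b, g a ≤ g b + |a - b|) :
    M.mean N π (T + 1) (fun q _ _ => g (q.total w)) ≤
      M.mean N π T (fun q _ s => g (q.unserved s (M.push w) + N * M.arrivalRate * w M.root)) +
        2 * √(N * M.numLevels) := by
  -- This scale balances `expect_abs_le`: the transition variance is at most the number of jobs,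
  -- with mean at most `N L`, and the arrival variance is at most `N ≤ N L`, so each source
  -- contributes at most `a`.
  set a := √((N : ℝ) * M.numLevels) with ha
  have hN' : (1 : ℝ) ≤ N := by exact_mod_cast hN
  have hL : (1 : ℝ) ≤ M.numLevels := by exact_mod_cast Nat.le_add_left 1 _
  have hNL : (0 : ℝ) < N * M.numLevels := by positivity
  have ha0 : 0 < a := Real.sqrt_pos.2 hNL
  have haa : a * a = N * M.numLevels := Real.mul_self_sqrt hNL.le
  have hstep : M.mean N π (T + 1) (fun q _ _ => g (q.total w)) ≤ M.mean N π T (fun q _ s =>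
      g (q.unserved s (M.push w) + N * M.arrivalRate * w M.root) +
        ((2 * a)⁻¹ * q.total 1 + (N / (2 * a) + a))) := by
    rw [mean_queue _ _ _ _ fun q => g (q.total w), expect_law_succ]
    refine PMF.expect_mono fun ω hω => ?_
    obtain ⟨hlen, hjobs⟩ := M.of_mem_support_law N π T (M.of_mem_support_periodLaw N π T hω).1
    have ht : ∀ j ∈ ω.1.2.jobs, j.1 < ω.1.1.length + 1 := fun j hj => by
      have := hjobs j hj
      omega
    simp only [M.total_nextQueue _ _ _ ht]
    have hZ1 := PMF.expect_abs_le _ ha0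
      (M.expect_transitionLaw_sq_le ω.1.2 ω.2.2 h0 h1)
    have hZ2 := PMF.expect_abs_le _ ha0 (expect_binomial_sq_le N M.arrivalRate)
    set m := ω.1.2.unserved ω.2.2 (M.push w) with hm
    calc _ ≤ (M.transitionLaw ω.1.2 ω.2.2).expect (fun f => (M.arrivalLaw N).expect fun n =>
          (g (m + N * M.arrivalRate * w M.root) + |∑ j, (f j).elim 0 w - m|) +
            |(n : ℝ) - N * M.arrivalRate|) := by
          refine PMF.expect_mono fun f _ => PMF.expect_mono fun n _ => ?_
          refine (hg _ (m + N * M.arrivalRate * w M.root)).trans ?_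
          rw [add_assoc]
          refine add_le_add le_rfl ?_
          have e : ∑ j, (f j).elim 0 w + n * w M.root - (m + N * M.arrivalRate * w M.root) =
              (∑ j, (f j).elim 0 w - m) + w M.root * (n - N * M.arrivalRate) := by ring
          rw [e]
          refine (abs_add_le _ _).trans (add_le_add le_rfl ?_)
          rw [abs_mul, abs_of_nonneg (h0 _)]
          exact mul_le_of_le_one_left (abs_nonneg _) (h1 _)
      _ = g (m + N * M.arrivalRate * w M.root) +
            (M.transitionLaw ω.1.2 ω.2.2).expect (fun f => |∑ j, (f j).elim 0 w - m|) +
            (M.arrivalLaw N).expect (fun n => |(n : ℝ) - N * M.arrivalRate|) := by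
          simp only [PMF.expect_add, PMF.expect_const]
      _ ≤ g (m + N * M.arrivalRate * w M.root) + (ω.1.2.total 1 / (2 * a) + a / 2) +
            (N / (2 * a) + a / 2) := by
          rw [arrivalLaw]
          gcongr
      _ = _ := by ring
  refine hstep.trans ?_
  rw [mean_add, mean_add, mean_const_mul, mean_const]
  have hJ := mul_le_mul_of_nonneg_left (M.mean_total_one_le N π T)
    (show 0 ≤ (2 * a)⁻¹ by positivity)
  have e1 : (2 * a)⁻¹ * (N * M.numLevels) = a / 2 := by
    rw [← haa]
    field_simp
  have e2 : (N : ℝ) / (2 * a) ≤ a / 2 := by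
    rw [← e1, div_eq_inv_mul]
    refine mul_le_mul_of_nonneg_left ?_ (by positivity)
    exact le_mul_of_one_le_right (by positivity) hL
  linarith

theorem mean_capacity_id (T : ℕ) :
    M.mean N π T (fun _ r _ => (r : ℝ)) = N * M.serviceRate := by
  rw [mean_capacity _ _ _ _ fun r => (r : ℝ), capacityLaw, expect_binomial_id]

theorem mean_capacity_abs_le (hN : 1 ≤ N) (T : ℕ) :
    M.mean N π T (fun _ r _ => |(r : ℝ) - N * M.serviceRate|) ≤ √N := by
  have hN' : (0 : ℝ) < N := by exact_mod_cast hN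
  rw [mean_capacity _ _ _ _ fun r => |(r : ℝ) - N * M.serviceRate|, capacityLaw]
  refine (PMF.expect_abs_le _ (Real.sqrt_pos.2 hN') (expect_binomial_sq_le N _)).trans ?_
  have h := Real.mul_self_sqrt hN'.le
  have h0 := Real.sqrt_pos.2 hN'
  refine le_of_eq ?_
  conv_lhs => rw [← h]
  rw [Real.sqrt_mul_self h0.le]
  field_simp
  ring

/-- The mean holding cost of period `T + 1`. -/
noncomputable def meanCost (T : ℕ) : ℝ := M.mean N π T fun q _ s => q.unserved s M.cost

theorem holdingCost_eq_unserved (h : Record S) :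
    h.holdingCost M.cost = h.queue.unserved h.served M.cost := rfl

/-- The cost of the recorded history decomposes by periods: a new record adds its own cost, and the
later randomness leaves earlier costs unchanged. -/
theorem expectedCost_eq (T : ℕ) :
    M.expectedCost N π T = ENNReal.ofReal (∑ t ∈ Finset.range T, M.meanCost N π t) := by
  have hnonneg : ∀ l : List (Record S), 0 ≤ (l.map (Record.holdingCost M.cost)).sum := by
    intro l
    refine List.sum_nonneg fun c hc => ?_
    obtain ⟨h, _, rfl⟩ := List.mem_map.1 hc
    exact Queue.unserved_nonneg _ _ fun i => (M.cost_pos i).le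
  rw [expectedCost, PMF.tsum_mul_ofReal _ (f := fun x : List (Record S) × Queue S =>
    (x.1.map (Record.holdingCost M.cost)).sum) fun x => hnonneg x.1]
  congr 1
  induction T with
  | zero =>
    rw [law, PMF.expect_pure]
    simp
  | succ T ih =>
    rw [expect_law_succ, Finset.sum_range_succ, ← ih]
    simp only [List.map_cons, List.sum_cons, PMF.expect_const, PMF.expect_add]
    rw [add_comm]
    refine congrArg₂ (· + ·) ?_ ?_
    · simp only [periodLaw, PMF.expect_bind, PMF.expect_map, PMF.expect_const]
    · simp only [holdingCost_eq_unserved, PMF.expect_const]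
      rfl

end Model

end UncertainCostQueue

namespace UncertainCostQueue

/-! ### Bounds on weighted jobs and the priority dichotomy -/

namespace Queue

variable {S : Type*} (q : Queue S) {s : Finset Job} {w : S → ℝ}

theorem unserved_le_total (h : ∀ i, 0 ≤ w i) : q.unserved s w ≤ q.total w := by
  rw [← q.served_add_unserved s w]
  exact le_add_of_nonneg_left (q.served_nonneg s h)

theorem total_zero : q.total (0 : S → ℝ) = 0 := by simp [total]

end Queue

theorem indicator_one_nonneg {S : Type*} (A : Set S) (i : S) : 0 ≤ A.indicator (1 : S → ℝ) i :=
  Set.indicator_nonneg (fun _ _ => zero_le_one) i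

theorem indicator_one_le_one {S : Type*} (A : Set S) (i : S) : A.indicator (1 : S → ℝ) i ≤ 1 :=
  Set.indicator_le_self' (fun _ _ => zero_le_one) i

/-- Under a priority rule, if `A` contains with a state all states of higher priority, then all
jobs in `A` are served or all servers are used for jobs in `A`. -/
theorem FeasiblePolicy.FollowsPriority.unserved_eq_zero_or {S : Type*} [Fintype S]
    {π : FeasiblePolicy S} {pos : S ≃ Fin (Fintype.card S)} (h : π.FollowsPriority pos)
    {A : Set S} (hA : ∀ i k, pos k ≤ pos i → i ∈ A → k ∈ A) {past : List (Record S)} {r : ℕ}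
    {q : Queue S} {s : Finset Job} (hs : s ∈ (π.select past r q).support) :
    q.unserved s (A.indicator 1) = 0 ∨ q.served s (A.indicator 1) = r := by
  obtain ⟨hcard, hprio⟩ := h past r q s hs
  have hsub := π.subset_jobs past r q s hs
  -- A job of `A` left behind shows that service was limited by capacity, and that every served job
  -- ranks at least as high and so lies in `A`.
  by_cases hex : ∃ j : q.jobs, (j : Job) ∉ s ∧ q.state j ∈ A
  · right
    obtain ⟨j, hjs, hjA⟩ := hex
    have hlt : s.card < q.jobs.card :=
      Finset.card_lt_card ⟨hsub, fun hle => hjs (hle j.2)⟩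
    have hr : s.card = r := by omega
    rw [← hr, ← q.served_one hsub]
    refine Finset.sum_congr rfl fun j' _ => ?_
    by_cases hj' : (j' : Job) ∈ s
    · rw [if_pos hj', if_pos hj', Set.indicator_of_mem (hA _ _ (hprio j' j hj' hjs) hjA)]
    · rw [if_neg hj', if_neg hj']
  · left
    push Not at hex
    refine Finset.sum_eq_zero fun j _ => ?_
    by_cases hj : (j : Job) ∈ s
    · rw [if_pos hj]
    · rw [if_neg hj, Set.indicator_of_notMem (hex j hj)]

namespace Model

variable {S : Type*} [Fintype S] [DecidableEq S] (M : Model S) (N : ℕ) (π : FeasiblePolicy S)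

/-! ### The lower bound for all feasible algorithms -/

theorem le_add_sum_of_step {a b : ℕ → ℝ} (h : ∀ t, a (t + 1) ≤ a t + b t) (n : ℕ) :
    a n ≤ a 0 + ∑ t ∈ Finset.range n, b t := by
  induction n with
  | zero => simp
  | succ n ih =>
    rw [Finset.sum_range_succ]
    linarith [h n]

/-- Weak duality at any nonnegative price: in the potential `V(γ, ·)`, service is charged at most
`γ` and waiting at most the holding cost plus the next potential. The remaining boundary term does
not depend on `n`. -/
theorem le_sum_meanCost_add {γ : ℝ} (hγ : 0 ≤ γ) (n : ℕ) :
    n * (N * ((M.arrivalRate : ℝ) * M.costToGo γ M.root - M.serviceRate * γ)) ≤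
      ∑ t ∈ Finset.range n, M.meanCost N π t + γ * (N * M.numLevels) := by
  have hstep : ∀ T, -M.mean N π (T + 1) (fun q _ _ => q.total (M.costToGo γ)) ≤
      -M.mean N π T (fun q _ _ => q.total (M.costToGo γ)) + (M.meanCost N π T -
        N * ((M.arrivalRate : ℝ) * M.costToGo γ M.root - M.serviceRate * γ)) := by
    intro T
    have h1 : M.mean N π T (fun q _ _ => q.total (M.costToGo γ)) ≤
        M.mean N π T (fun q r s => γ * (r : ℝ) +
          (q.unserved s M.cost + q.unserved s (M.push (M.costToGo γ)))) := by
      refine M.mean_mono fun past r q s hs => ?_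
      rw [← q.served_add_unserved s, ← Queue.unserved_add]
      refine add_le_add ?_ (Queue.unserved_mono fun i => ?_)
      · calc q.served s (M.costToGo γ) ≤ q.served s (fun i => γ * (1 : S → ℝ) i) :=
              Queue.served_mono fun i => by simpa using M.costToGo_le γ i
          _ = γ * s.card := by
              rw [Queue.served_const_mul, q.served_one (π.subset_jobs past r q s hs)]
          _ ≤ γ * r := by
              have : (s.card : ℝ) ≤ r := by exact_mod_cast π.card_le past r q s hs
              gcongr
      · rw [← M.index_eq]
        exact M.costToGo_le_index γ i
    rw [mean_add, mean_add, mean_const_mul, mean_capacity_id] at h1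
    rw [mean_total_succ, meanCost]
    linarith
  have h := le_add_sum_of_step
    (a := fun T => -M.mean N π T (fun q _ _ => q.total (M.costToGo γ))) hstep n
  rw [mean_total_zero _ _ _ fun x => x, Finset.sum_sub_distrib, Finset.sum_const,
    Finset.card_range, nsmul_eq_mul] at h
  suffices hn : M.mean N π n (fun q _ _ => q.total (M.costToGo γ)) ≤ γ * (N * M.numLevels) by
    linarith
  calc M.mean N π n (fun q _ _ => q.total (M.costToGo γ))
      ≤ M.mean N π n (fun q _ _ => γ * q.total 1) := by
        refine M.mean_mono fun past r q s hs => ?_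
        rw [← Queue.total_const_mul]
        exact q.total_mono fun i => by simpa using M.costToGo_le γ i
    _ ≤ γ * (N * M.numLevels) := by
        rw [mean_const_mul]
        exact mul_le_mul_of_nonneg_left (M.mean_total_one_le N π n) hγ

/-! ### Concentration -/

/-- The excess over the fluid mean is traced back through the ages of jobs. Each step replaces `w`
by `P w`, splits off the arrivals of one period and costs one fluctuation; service only reduces the
count, and nilpotency ends the recursion. -/
theorem mean_total_sub_le (hN : 1 ≤ N) (m T : ℕ) {w : S → ℝ} (h0 : ∀ i, 0 ≤ w i)
    (h1 : ∀ i, w i ≤ 1) (hw : (M.push ^ m) w = 0) :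
    M.mean N π T (fun q _ _ => max (q.total w -
      N * M.arrivalRate * ∑ j ∈ Finset.range m, (M.push ^ j) w M.root) 0) ≤
      m * (2 * √(N * M.numLevels)) := by
  induction m generalizing T w with
  | zero =>
    rw [pow_zero, Module.End.one_apply] at hw
    simp [hw, Queue.total_zero, mean_const]
  | succ m ih =>
    have hc : 0 ≤ N * (M.arrivalRate : ℝ) *
        ∑ j ∈ Finset.range (m + 1), (M.push ^ j) w M.root :=
      mul_nonneg (mul_nonneg N.cast_nonneg M.arrivalRate.2.1)
        (Finset.sum_nonneg fun j _ => (M.push_pow_mem h0 h1 j).1 _)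
    cases T with
    | zero =>
      rw [mean_total_zero _ _ _ fun x => max (x - N * M.arrivalRate *
        ∑ j ∈ Finset.range (m + 1), (M.push ^ j) w M.root) 0, max_eq_right (by linarith)]
      positivity
    | succ T =>
      have h2 := M.mean_lipschitz_total_succ_le N π hN T h0 h1 (g := fun x => max (x -
        N * M.arrivalRate * ∑ j ∈ Finset.range (m + 1), (M.push ^ j) w M.root) 0) (by
          intro a b
          refine max_le ?_ (by positivity)
          have := le_max_left (b - N * (M.arrivalRate : ℝ) *
            ∑ j ∈ Finset.range (m + 1), (M.push ^ j) w M.root) 0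
          have := le_abs_self (a - b)
          linarith)
      refine h2.trans ?_
      have h3 := ih T (w := M.push w) (M.push_nonneg h0) (M.push_le_one h1)
        (by rw [← Module.End.mul_apply, ← pow_succ, hw])
      have h4 : M.mean N π T (fun q _ s => max (q.unserved s (M.push w) +
          N * M.arrivalRate * w M.root - N * M.arrivalRate *
            ∑ j ∈ Finset.range (m + 1), (M.push ^ j) w M.root) 0) ≤
          M.mean N π T (fun q _ _ => max (q.total (M.push w) -
            N * M.arrivalRate * ∑ j ∈ Finset.range m, (M.push ^ j) (M.push w) M.root) 0) := by
        refine M.mean_mono fun past r q s hs => max_le_max ?_ le_rfl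
        have := q.unserved_le_total (s := s) (M.push_nonneg h0)
        rw [Finset.sum_range_succ', pow_zero, Module.End.one_apply]
        simp only [pow_succ, Module.End.mul_apply]
        linarith
      push_cast
      linarith

/-- For a shortfall, service acts in the wrong direction: a job served now is missing at every later
age, which produces the weight `P^(j+1) w`. Its effect is delayed, so the estimate is summed over
time; `K` collects the initial shortfalls of the empty system. -/
theorem sum_mean_sub_total_le (hN : 1 ≤ N) (m : ℕ) {w : S → ℝ} (h0 : ∀ i, 0 ≤ w i)
    (h1 : ∀ i, w i ≤ 1) :
    ∃ K : ℝ, ∀ n : ℕ, ∑ T ∈ Finset.range n, M.mean N π T (fun q _ _ => max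
      (N * M.arrivalRate * ∑ j ∈ Finset.range m, (M.push ^ j) w M.root - q.total w) 0) ≤
      K + n * (m * (2 * √(N * M.numLevels))) + ∑ T ∈ Finset.range n, M.mean N π T (fun q _ s =>
        q.served s (fun i => ∑ j ∈ Finset.range m, (M.push ^ (j + 1)) w i)) := by
  induction m generalizing w with
  | zero =>
    refine ⟨0, fun n => ?_⟩
    have h2 : ∑ T ∈ Finset.range n, M.mean N π T (fun q _ _ => max (N * M.arrivalRate *
        ∑ j ∈ Finset.range 0, (M.push ^ j) w M.root - q.total w) 0) ≤ 0 := by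
      refine Finset.sum_nonpos fun T _ => ?_
      refine le_of_le_of_eq ?_ (M.mean_const (N := N) (π := π) T 0)
      refine M.mean_mono fun past r q s hs => max_le ?_ le_rfl
      simpa using q.total_nonneg h0
    refine h2.trans_eq ?_
    simp [Queue.served, mean_const]
  | succ m ih =>
    obtain ⟨K, hK⟩ := ih (w := M.push w) (M.push_nonneg h0) (M.push_le_one h1)
    set c := N * (M.arrivalRate : ℝ) * ∑ j ∈ Finset.range (m + 1), (M.push ^ j) w M.root with hc
    set c' := N * (M.arrivalRate : ℝ) * ∑ j ∈ Finset.range m, (M.push ^ j) (M.push w) M.root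
      with hc'
    have hcc : c = c' + N * M.arrivalRate * w M.root := by
      rw [hc, hc', Finset.sum_range_succ', pow_zero, Module.End.one_apply]
      simp only [pow_succ, Module.End.mul_apply]
      ring
    have hstep : ∀ T, M.mean N π (T + 1) (fun q _ _ => max (c - q.total w) 0) ≤
        M.mean N π T (fun q _ _ => max (c' - q.total (M.push w)) 0) +
          M.mean N π T (fun q _ s => q.served s (M.push w)) + 2 * √(N * M.numLevels) := by
      intro T
      have h2 := M.mean_lipschitz_total_succ_le N π hN T h0 h1 (g := fun x => max (c - x) 0) (by
          intro a b
          refine max_le ?_ (by positivity)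
          have := le_max_left (c - b) 0
          have := neg_abs_le (a - b)
          linarith)
      refine h2.trans (add_le_add ?_ le_rfl)
      rw [← mean_add]
      refine M.mean_mono fun past r q s hs => ?_
      have h3 := q.served_add_unserved s (M.push w)
      have h4 := q.served_nonneg s (M.push_nonneg h0)
      have h5 := le_max_left (c' - q.total (M.push w)) 0
      have h6 := le_max_right (c' - q.total (M.push w)) 0
      exact max_le (by linarith) (by linarith)
    refine ⟨K + M.mean N π 0 (fun q _ _ => max (c - q.total w) 0), fun n => ?_⟩
    have hserved : ∀ T, M.mean N π T (fun q _ s =>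
          q.served s (fun i => ∑ j ∈ Finset.range (m + 1), (M.push ^ (j + 1)) w i)) =
        M.mean N π T (fun q _ s =>
          q.served s (fun i => ∑ j ∈ Finset.range m, (M.push ^ (j + 1)) (M.push w) i)) +
        M.mean N π T (fun q _ s => q.served s (M.push w)) := by
      intro T
      simp only [Finset.sum_range_succ', Queue.served_add, mean_add]
      simp only [pow_succ, Module.End.mul_apply, pow_zero, Module.End.one_apply]
    calc ∑ T ∈ Finset.range n, M.mean N π T (fun q _ _ => max (c - q.total w) 0)
        -- One extra nonnegative term allows the shift in time: the initial term goes into `K`, and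
        -- all others come from a preceding period.
        ≤ ∑ T ∈ Finset.range (n + 1), M.mean N π T (fun q _ _ => max (c - q.total w) 0) := by
          rw [Finset.sum_range_succ]
          exact le_add_of_nonneg_right (PMF.expect_nonneg fun _ _ => le_max_right _ _)
      _ = ∑ T ∈ Finset.range n, M.mean N π (T + 1) (fun q _ _ => max (c - q.total w) 0) +
            M.mean N π 0 (fun q _ _ => max (c - q.total w) 0) := Finset.sum_range_succ' _ _
      _ ≤ ∑ T ∈ Finset.range n, (M.mean N π T (fun q _ _ => max (c' - q.total (M.push w)) 0) +
            M.mean N π T (fun q _ s => q.served s (M.push w)) + 2 * √(N * M.numLevels)) +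
            M.mean N π 0 (fun q _ _ => max (c - q.total w) 0) := by
          gcongr with T _
          exact hstep T
      _ ≤ _ := by
          simp only [hserved, Finset.sum_add_distrib, Finset.sum_const, Finset.card_range,
            nsmul_eq_mul]
          have := hK n
          push_cast
          linarith

/-! ### Overload and idleness under a priority rule -/

/-- Jobs left unserved in `A` when the capacity suffices for the jobs reaching `A`. -/
theorem sum_mean_unserved_le (hN : 1 ≤ N) {A : Set S}
    (hA : (M.arrivalRate : ℝ) * M.hitProb A M.root ≤ M.serviceRate)
    (hπ : ∀ past r q, ∀ s ∈ (π.select past r q).support,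
      q.unserved s (A.indicator 1) = 0 ∨ q.served s (A.indicator 1) = r) (n : ℕ) :
    M.minAbandonProb *
        ∑ T ∈ Finset.range n, M.mean N π T (fun q _ s => q.unserved s (A.indicator 1)) ≤
      n * (√N + M.numLevels * (2 * √(N * M.numLevels))) := by
  -- Repeat visits are bounded, summed over time, by `1 - θ` times the jobs left unserved in `A`.
  have hlater : ∀ T, M.mean N π (T + 1) (fun q _ _ => q.total (M.laterHitProb A)) ≤
      M.mean N π T (fun q _ _ => q.total (M.laterHitProb A)) +
      ((1 - M.minAbandonProb) * M.mean N π T (fun q _ s => q.unserved s (A.indicator 1)) -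
        M.mean N π T (fun q _ _ => q.total ((M.laterHit A).indicator 1))) := by
    intro T
    rw [mean_total_succ, M.laterHitProb_root, mul_zero, add_zero, ← mean_const_mul, ← mean_sub,
      ← mean_add]
    refine M.mean_mono fun past r q s hs => ?_
    have h1 : q.unserved s (M.push (M.laterHitProb A)) ≤
        q.unserved s (fun i => (M.laterHitProb A i - (M.laterHit A).indicator 1 i) +
          (1 - M.minAbandonProb) * A.indicator 1 i) :=
      Queue.unserved_mono (M.push_laterHitProb_le A)
    rw [Queue.unserved_add, Queue.unserved_const_mul] at h1
    have h2 := q.unserved_le_total (s := s)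
      fun i => sub_nonneg.2 (M.laterHit_le_laterHitProb A i)
    rw [Queue.total_sub] at h2
    linarith
  -- If jobs of `A` are left over, all `r` servers were used on `A`. First visits and `r` are then
  -- compared through their means `N λ h ≤ N μ`, leaving only fluctuations and repeat visits.
  have hoverload : ∀ T, M.mean N π T (fun q _ s => q.unserved s (A.indicator 1)) ≤
      M.numLevels * (2 * √(N * M.numLevels)) + √N +
        M.mean N π T (fun q _ _ => q.total ((M.laterHit A).indicator 1)) := by
    intro T
    have h1 := M.mean_total_sub_le N π hN M.numLevels T (indicator_one_nonneg (M.firstHit A))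
      (indicator_one_le_one _) (M.push_pow_numLevels _)
    rw [M.sum_push_pow_firstHit_root] at h1
    refine le_trans ?_ (add_le_add (add_le_add h1 (M.mean_capacity_abs_le N π hN T)) le_rfl)
    rw [← mean_add, ← mean_add]
    refine M.mean_mono fun past r q s hs => ?_
    set x := q.total ((M.firstHit A).indicator 1) - N * M.arrivalRate * M.hitProb A M.root
    have hx := le_max_left x 0
    have hx0 := le_max_right x 0
    have hr0 := abs_nonneg ((r : ℝ) - N * M.serviceRate)
    have hr := neg_abs_le ((r : ℝ) - N * M.serviceRate)
    have hl := q.total_nonneg (indicator_one_nonneg (M.laterHit A))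
    rcases hπ past r q s hs with h | h
    · rw [h]
      positivity
    · have h2 := q.served_add_unserved s (A.indicator 1)
      have h3 : q.total (A.indicator 1) = q.total ((M.firstHit A).indicator 1) +
          q.total ((M.laterHit A).indicator 1) := by
        rw [← Queue.total_add]
        exact congrArg q.total (funext (M.indicator_eq_firstHit_add A))
      have h4 := mul_le_mul_of_nonneg_left hA (Nat.cast_nonneg (α := ℝ) N)
      have h5 : x = q.total ((M.firstHit A).indicator 1) -
        N * M.arrivalRate * M.hitProb A M.root := rfl
      linarith
  have hsum := le_add_sum_of_step
    (a := fun T => M.mean N π T (fun q _ _ => q.total (M.laterHitProb A))) hlater n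
  have h0 : 0 ≤ M.mean N π n (fun q _ _ => q.total (M.laterHitProb A)) :=
    PMF.expect_nonneg fun _ _ => Queue.total_nonneg _ (M.laterHitProb_nonneg A)
  rw [mean_total_zero _ _ _ fun x => x, Finset.sum_sub_distrib, ← Finset.mul_sum] at hsum
  have hsum2 := Finset.sum_le_sum fun T (_ : T ∈ Finset.range n) => hoverload T
  rw [Finset.sum_add_distrib, Finset.sum_const, Finset.card_range, nsmul_eq_mul] at hsum2
  linarith

/-- Servers not used for jobs in `A` when the jobs reaching `A` suffice to occupy them. -/
theorem sum_mean_idle_le (hN : 1 ≤ N) {A : Set S}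
    (hA : (M.serviceRate : ℝ) ≤ M.arrivalRate * M.hitProb A M.root)
    (hπ : ∀ past r q, ∀ s ∈ (π.select past r q).support,
      q.unserved s (A.indicator 1) = 0 ∨ q.served s (A.indicator 1) = r) :
    ∃ K : ℝ, ∀ n : ℕ, M.minAbandonProb *
        ∑ T ∈ Finset.range n, M.mean N π T (fun q r s => (r : ℝ) - q.served s (A.indicator 1)) ≤
      K + n * (√N + M.numLevels * (2 * √(N * M.numLevels))) := by
  obtain ⟨K, hK⟩ := M.sum_mean_sub_total_le N π hN M.numLevels
    (indicator_one_nonneg (M.firstHit A)) (indicator_one_le_one _)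
  refine ⟨K, fun n => ?_⟩
  have hKn := hK n
  have hpush : (fun i => ∑ j ∈ Finset.range M.numLevels,
      (M.push ^ (j + 1)) ((M.firstHit A).indicator 1) i) = M.push (M.firstHitProb A) := by
    rw [← M.sum_push_pow_firstHit_numLevels, map_sum]
    funext i
    rw [Finset.sum_apply]
    simp only [pow_succ', Module.End.mul_apply]
  rw [hpush, M.sum_push_pow_firstHit_root] at hKn
  have hidle : ∀ T, M.mean N π T (fun q r s => (r : ℝ) - q.served s (A.indicator 1)) ≤
      M.mean N π T (fun q _ _ => max (N * M.arrivalRate * M.hitProb A M.root -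
        q.total ((M.firstHit A).indicator 1)) 0) + √N := by
    intro T
    refine le_trans ?_ (add_le_add le_rfl (M.mean_capacity_abs_le N π hN T))
    rw [← mean_add]
    refine M.mean_mono fun past r q s hs => ?_
    set x := N * (M.arrivalRate : ℝ) * M.hitProb A M.root - q.total ((M.firstHit A).indicator 1)
    have hx := le_max_left x 0
    have hx0 := le_max_right x 0
    have hr0 := abs_nonneg ((r : ℝ) - N * M.serviceRate)
    have hr := le_abs_self ((r : ℝ) - N * M.serviceRate)
    rcases hπ past r q s hs with h | h
    · have h2 := q.served_add_unserved s (A.indicator 1)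
      have h3 : q.total ((M.firstHit A).indicator 1) ≤ q.total (A.indicator 1) :=
        q.total_mono fun i => Set.indicator_le_indicator_of_subset (fun i hi => hi.1)
          (fun _ => zero_le_one) i
      have h4 := mul_le_mul_of_nonneg_left hA (Nat.cast_nonneg (α := ℝ) N)
      have h5 : x = N * (M.arrivalRate : ℝ) * M.hitProb A M.root -
        q.total ((M.firstHit A).indicator 1) := rfl
      linarith
    · rw [h, sub_self]
      positivity
  -- Servers used outside `A` are among those not used for `A`, and each destroys at most `1 - θ`
  -- first visits. The sum over time therefore reappears on the right with factor `1 - θ` and is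
  -- absorbed.
  have hlost : ∀ T, M.mean N π T (fun q _ s => q.served s (M.push (M.firstHitProb A))) ≤
      (1 - M.minAbandonProb) *
        M.mean N π T (fun q r s => (r : ℝ) - q.served s (A.indicator 1)) := by
    intro T
    rw [← mean_const_mul]
    refine M.mean_mono fun past r q s hs => ?_
    have h1 : q.served s (M.push (M.firstHitProb A)) ≤
        q.served s (fun i => (1 - M.minAbandonProb) * Aᶜ.indicator 1 i) :=
      Queue.served_mono (M.push_firstHitProb_le A)
    rw [Queue.served_const_mul] at h1
    have h2 : q.served s (A.indicator 1) + q.served s (Aᶜ.indicator 1) = s.card := by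
      rw [← Queue.served_add, ← q.served_one (π.subset_jobs past r q s hs)]
      exact congrArg (q.served s) (Set.indicator_self_add_compl A (1 : S → ℝ))
    have h3 : (s.card : ℝ) ≤ r := by exact_mod_cast π.card_le past r q s hs
    exact h1.trans (mul_le_mul_of_nonneg_left (by linarith)
      (sub_nonneg.2 M.minAbandonProb_le_one))
  have hsum := Finset.sum_le_sum fun T (_ : T ∈ Finset.range n) => hidle T
  have hsum2 := Finset.sum_le_sum fun T (_ : T ∈ Finset.range n) => hlost T
  rw [Finset.sum_add_distrib, Finset.sum_const, Finset.card_range, nsmul_eq_mul] at hsum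
  rw [← Finset.mul_sum] at hsum2
  linarith

/-! ### The cost of the algorithm -/

/-- The total cost over a finite horizon, compared with the dual value, in terms of the work left
undone above the price and the capacity not used at or above it. -/
theorem sum_meanCost_le {γ : ℝ} (hγ : 0 ≤ γ) (hθ : 0 < M.minAbandonProb) (n : ℕ) :
    ∑ t ∈ Finset.range n, M.meanCost N π t ≤
      n * (N * ((M.arrivalRate : ℝ) * M.costToGo γ M.root - M.serviceRate * γ)) +
      M.maxCost / M.minAbandonProb * ∑ T ∈ Finset.range n,
        M.mean N π T (fun q _ s => q.unserved s ((M.above γ).indicator 1)) +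
      γ * ∑ T ∈ Finset.range n,
        M.mean N π T (fun q r s => (r : ℝ) - q.served s ((M.atLeast γ).indicator 1)) := by
  set B := M.maxCost / M.minAbandonProb with hB
  have hstep : ∀ T, M.mean N π (T + 1) (fun q _ _ => q.total (M.costToGo γ)) ≤
      M.mean N π T (fun q _ _ => q.total (M.costToGo γ)) +
      ((N * ((M.arrivalRate : ℝ) * M.costToGo γ M.root - M.serviceRate * γ) +
        B * M.mean N π T (fun q _ s => q.unserved s ((M.above γ).indicator 1)) +
        γ * M.mean N π T (fun q r s => (r : ℝ) - q.served s ((M.atLeast γ).indicator 1))) -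
        M.meanCost N π T) := by
    intro T
    have h1 : M.mean N π T (fun q r s => γ * (r : ℝ) +
        (q.unserved s M.cost + q.unserved s (M.push (M.costToGo γ)))) ≤
        M.mean N π T (fun q r s => q.total (M.costToGo γ) +
          (B * q.unserved s ((M.above γ).indicator 1) +
            γ * ((r : ℝ) - q.served s ((M.atLeast γ).indicator 1)))) := by
      refine M.mean_mono fun past r q s hs => ?_
      rw [← q.served_add_unserved s (M.costToGo γ), ← Queue.unserved_add]
      -- For unserved jobs the Bellman equation is exact unless the index exceeds the price; the
      -- defect is then at most the largest index. For served jobs, `V = γ` exactly when the index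
      -- is at least `γ`.
      have h2 : q.unserved s (fun i => M.cost i + M.push (M.costToGo γ) i) ≤
          q.unserved s (fun i => M.costToGo γ i + B * (M.above γ).indicator 1 i) := by
        refine Queue.unserved_mono fun i => ?_
        rw [← M.index_eq]
        by_cases hi : i ∈ M.above γ
        · rw [Set.indicator_of_mem hi, Pi.one_apply, mul_one]
          exact (M.index_le hθ γ i).trans (le_add_of_nonneg_left (M.costToGo_nonneg hγ i))
        · rw [Set.indicator_of_notMem hi, mul_zero, add_zero, M.costToGo_eq_min,
            min_eq_right (not_lt.1 hi)]
      have h3 : q.served s (fun i => γ * (M.atLeast γ).indicator 1 i) ≤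
          q.served s (M.costToGo γ) := by
        refine Queue.served_mono fun i => ?_
        by_cases hi : i ∈ M.atLeast γ
        · rw [Set.indicator_of_mem hi, Pi.one_apply, mul_one, M.costToGo_eq_min,
            min_eq_left (by exact hi)]
        · rw [Set.indicator_of_notMem hi, mul_zero]
          exact M.costToGo_nonneg hγ i
      rw [Queue.unserved_add _ _ _ (M.costToGo γ), Queue.unserved_const_mul] at h2
      rw [Queue.served_const_mul] at h3
      linarith
    rw [mean_add, mean_add, mean_add, mean_add, mean_const_mul, mean_const_mul, mean_const_mul,
      mean_capacity_id] at h1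
    rw [mean_total_succ]
    unfold meanCost
    linarith
  have h := le_add_sum_of_step
    (a := fun T => M.mean N π T (fun q _ _ => q.total (M.costToGo γ))) hstep n
  have h0 : 0 ≤ M.mean N π n (fun q _ _ => q.total (M.costToGo γ)) :=
    PMF.expect_nonneg fun _ _ => Queue.total_nonneg _ (M.costToGo_nonneg hγ)
  rw [mean_total_zero _ _ _ fun x => x, Finset.sum_sub_distrib, Finset.sum_add_distrib,
    Finset.sum_add_distrib, Finset.sum_const, Finset.card_range, nsmul_eq_mul, ← Finset.mul_sum,
    ← Finset.mul_sum] at h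
  linarith

variable {N π} in
/-- The cost of the algorithm exceeds the dual value by a term of order `√N` per period, up to a
constant due to the empty initial state. -/
theorem sum_meanCost_le_of_followsPriority (hN : 1 ≤ N) (hθ : 0 < M.minAbandonProb) {γ : ℝ}
    (hγ : M.IsCapacityPrice γ) {pos : S ≃ Fin (Fintype.card S)}
    (hpos : ∀ i k, M.index γ k < M.index γ i → pos i < pos k) (hπ : π.FollowsPriority pos) :
    ∃ K : ℝ, ∀ n : ℕ, ∑ t ∈ Finset.range n, M.meanCost N π t ≤
      n * (N * ((M.arrivalRate : ℝ) * M.costToGo γ M.root - M.serviceRate * γ) +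
        2 * (M.maxCost * (M.minAbandonProb ^ 2)⁻¹) *
          (√N + M.numLevels * (2 * √(N * M.numLevels)))) + K := by
  have hmono : ∀ i k, pos k ≤ pos i → M.index γ i ≤ M.index γ k := by
    intro i k hik
    by_contra! hlt
    exact absurd (hpos i k hlt) (not_lt.2 hik)
  set E : ℝ := √N + M.numLevels * (2 * √(N * M.numLevels)) with hE
  have hE0 : 0 ≤ E := by positivity
  set B := M.maxCost / M.minAbandonProb with hB
  have hB0 : 0 ≤ B := div_nonneg M.maxCost_pos.le hθ.le
  have hidle : ∃ K : ℝ, ∀ n : ℕ, γ * (M.minAbandonProb * ∑ T ∈ Finset.range n,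
      M.mean N π T (fun q r s => (r : ℝ) - q.served s ((M.atLeast γ).indicator 1))) ≤
      γ * (K + n * E) := by
    -- At price zero idle capacity costs nothing, which covers the case where the left first-order
    -- condition is unavailable.
    rcases hγ.1.eq_or_lt with h0 | h0
    · exact ⟨0, fun n => by simp [← h0]⟩
    · obtain ⟨K, hK⟩ := M.sum_mean_idle_le N π hN (hγ.serviceRate_le h0) fun past r q s hs =>
        hπ.unserved_eq_zero_or (fun i k hik hi => le_trans hi (hmono i k hik)) hs
      exact ⟨K, fun n => mul_le_mul_of_nonneg_left (hK n) h0.le⟩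
  obtain ⟨K, hK⟩ := hidle
  refine ⟨γ * K / M.minAbandonProb, fun n => ?_⟩
  have hU := M.sum_mean_unserved_le N π hN hγ.arrivalRate_mul_hitProb_le (fun past r q s hs =>
    hπ.unserved_eq_zero_or (fun i k hik hi => lt_of_lt_of_le hi (hmono i k hik)) hs) n
  have hcost := M.sum_meanCost_le N π hγ.1 hθ n
  set U := ∑ T ∈ Finset.range n,
    M.mean N π T (fun q _ s => q.unserved s ((M.above γ).indicator 1))
  set D := ∑ T ∈ Finset.range n,
    M.mean N π T (fun q r s => (r : ℝ) - q.served s ((M.atLeast γ).indicator 1))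
  have h1 : B * U ≤ B * (n * E / M.minAbandonProb) :=
    mul_le_mul_of_nonneg_left (by rw [le_div_iff₀' hθ]; exact hU) hB0
  have h2 : γ * D ≤ γ * (K + n * E) / M.minAbandonProb := by
    rw [le_div_iff₀' hθ]
    linarith [hK n]
  have h3 : γ * (n * E) / M.minAbandonProb ≤ B * (n * E) / M.minAbandonProb := by
    -- With `γ ≤ c_max / θ` the idleness term has the same bound as the overload term, whence the
    -- factor `2`.
    have := hγ.le hθ
    gcongr
  have h4 : B * (n * E / M.minAbandonProb) =
      n * (M.maxCost * (M.minAbandonProb ^ 2)⁻¹ * E) := by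
    rw [hB]
    field_simp
  have h5 : γ * (K + n * E) / M.minAbandonProb =
      γ * K / M.minAbandonProb + γ * (n * E) / M.minAbandonProb := by ring
  have h6 : B * (n * E) / M.minAbandonProb = B * (n * E / M.minAbandonProb) := by ring
  linarith

end Model

end UncertainCostQueue

namespace UncertainCostQueue

/-! ### Existence of the algorithm -/

/-- The `n` first elements of a finite set in the order given by `f`. -/
theorem exists_subset_card_eq_of_priority {α : Type*} [DecidableEq α] (J : Finset α) (f : α → ℕ)
    (n : ℕ) (hn : n ≤ J.card) :
    ∃ s ⊆ J, s.card = n ∧ ∀ j ∈ s, ∀ j' ∈ J, j' ∉ s → f j ≤ f j' := by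
  induction n with
  | zero => exact ⟨∅, by simp⟩
  | succ n ih =>
    obtain ⟨s, hsJ, hcard, hs⟩ := ih (by omega)
    have hne : (J \ s).Nonempty := by
      rw [← Finset.card_pos, Finset.card_sdiff_of_subset hsJ]
      omega
    obtain ⟨a, ha, hmin⟩ := Finset.exists_min_image (J \ s) f hne
    obtain ⟨haJ, has⟩ := Finset.mem_sdiff.1 ha
    refine ⟨insert a s, Finset.insert_subset haJ hsJ, by rw [Finset.card_insert_of_notMem has, hcard],
      fun j hj j' hj' hj's => ?_⟩
    rw [Finset.mem_insert, not_or] at hj's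
    rcases Finset.mem_insert.1 hj with rfl | hj
    · exact hmin j' (Finset.mem_sdiff.2 ⟨hj', hj's.2⟩)
    · exact hs j hj j' hj' hj's.2

theorem exists_followsPriority {S : Type*} [Fintype S] (pos : S ≃ Fin (Fintype.card S)) :
    ∃ π : FeasiblePolicy S, π.FollowsPriority pos := by
  classical
  have h : ∀ (r : ℕ) (q : Queue S), ∃ s ⊆ q.jobs, s.card = min r q.jobs.card ∧
      ∀ j j' : q.jobs, (j : Job) ∈ s → (j' : Job) ∉ s → pos (q.state j) ≤ pos (q.state j') := by
    intro r q
    obtain ⟨s, hsub, hcard, hs⟩ := exists_subset_card_eq_of_priority q.jobs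
      (fun j => if hj : j ∈ q.jobs then (pos (q.state ⟨j, hj⟩) : ℕ) else 0)
      (min r q.jobs.card) (min_le_right _ _)
    refine ⟨s, hsub, hcard, fun j j' hj hj' => ?_⟩
    have := hs j hj j' j'.2 hj'
    simpa using this
  choose sel hsub hcard hprio using h
  refine ⟨⟨fun _ r q => PMF.pure (sel r q), fun _ r q s hs => ?_, fun _ r q s hs => ?_⟩,
    fun _ r q s hs => ?_⟩
  · rw [PMF.mem_support_pure_iff] at hs
    exact hs ▸ hsub r q
  · rw [PMF.mem_support_pure_iff] at hs
    exact hs ▸ (hcard r q).trans_le (min_le_left _ _)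
  · rw [PMF.mem_support_pure_iff] at hs
    subst hs
    exact ⟨hcard r q, hprio r q⟩

/-- A finite type can be enumerated in decreasing order of a real function. -/
theorem exists_equiv_fin_antitone {S : Type*} [Fintype S] (f : S → ℝ) :
    ∃ pos : S ≃ Fin (Fintype.card S), ∀ i k, f k < f i → pos i < pos k := by
  set e := Fintype.equivFin S
  set σ := Tuple.sort fun a => -f (e.symm a)
  have hσ : Monotone ((fun a => -f (e.symm a)) ∘ σ) := Tuple.monotone_sort _
  refine ⟨e.trans σ.symm, fun i k hik => ?_⟩
  by_contra! hle
  have := hσ hle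
  simp only [Function.comp_apply, Equiv.trans_apply, Equiv.apply_symm_apply,
    Equiv.symm_apply_apply] at this
  linarith

namespace Model

variable {S : Type*} [Fintype S] [DecidableEq S] (M : Model S)

theorem exists_isOaRC (hθ : 0 < M.minAbandonProb) : ∃ π : FeasiblePolicy S, M.IsOaRC π := by
  obtain ⟨γ, hγ⟩ := M.exists_isCapacityPrice hθ
  obtain ⟨pos, hpos⟩ := exists_equiv_fin_antitone (M.index γ)
  obtain ⟨π, hπ⟩ := exists_followsPriority pos
  exact ⟨π, γ, hγ, pos, hpos, hπ⟩

/-! ### Long-run averages -/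

theorem tendsto_add_div_nat (a b : ℝ) :
    Filter.Tendsto (fun n : ℕ => a + b / n) Filter.atTop (nhds a) := by
  simpa using (tendsto_const_nhds (x := a)).add (tendsto_const_div_atTop_nhds_zero_nat b)

theorem expectedCost_div (N : ℕ) (π : FeasiblePolicy S) {n : ℕ} (hn : 0 < n) :
    M.expectedCost N π n / n =
      ENNReal.ofReal ((∑ t ∈ Finset.range n, M.meanCost N π t) / n) := by
  rw [expectedCost_eq, ENNReal.ofReal_div_of_pos (by exact_mod_cast hn), ENNReal.ofReal_natCast]

/-- The horizon-independent boundary term disappears after division by the horizon. -/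
theorem longRunCost_le {N : ℕ} {π : FeasiblePolicy S} {a b : ℝ}
    (h : ∀ n : ℕ, ∑ t ∈ Finset.range n, M.meanCost N π t ≤ n * a + b) :
    M.longRunCost N π ≤ ENNReal.ofReal a := by
  have hlim : Filter.Tendsto (fun n : ℕ => ENNReal.ofReal (a + b / n)) Filter.atTop
      (nhds (ENNReal.ofReal a)) := ENNReal.tendsto_ofReal (tendsto_add_div_nat a b)
  rw [longRunCost, ← hlim.limsup_eq]
  refine Filter.limsup_le_limsup ?_
  filter_upwards [Filter.eventually_gt_atTop 0] with n hn
  rw [M.expectedCost_div N π hn]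
  refine ENNReal.ofReal_le_ofReal ?_
  have hn' : (0 : ℝ) < n := by exact_mod_cast hn
  rw [div_le_iff₀ hn']
  have e : (a + b / n) * n = n * a + b := by field_simp
  rw [e]
  exact h n

theorem le_longRunCost {N : ℕ} {π : FeasiblePolicy S} {a b : ℝ}
    (h : ∀ n : ℕ, n * a ≤ ∑ t ∈ Finset.range n, M.meanCost N π t + b) :
    ENNReal.ofReal a ≤ M.longRunCost N π := by
  have hlim : Filter.Tendsto (fun n : ℕ => ENNReal.ofReal (a + (-b) / n)) Filter.atTop
      (nhds (ENNReal.ofReal a)) := ENNReal.tendsto_ofReal (tendsto_add_div_nat a (-b))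
  rw [longRunCost, ← hlim.limsup_eq]
  refine Filter.limsup_le_limsup ?_
  filter_upwards [Filter.eventually_gt_atTop 0] with n hn
  rw [M.expectedCost_div N π hn]
  refine ENNReal.ofReal_le_ofReal ?_
  have hn' : (0 : ℝ) < n := by exact_mod_cast hn
  rw [le_div_iff₀ hn']
  have e : (a + (-b) / n) * n = n * a - b := by field_simp; ring
  rw [e]
  linarith [h n]

/-- The cost of the algorithm is finite and its regret is of order `√N`. -/
theorem IsOaRC.longRunCost_ne_top_and_regret_le {M : Model S} (hθ : 0 < M.minAbandonProb) {N : ℕ}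
    (hN : 1 ≤ N) {π : FeasiblePolicy S} (hπ : M.IsOaRC π) :
    M.longRunCost N π ≠ ⊤ ∧ 0 ≤ M.regret N π ∧ M.regret N π ≤
      2 * (M.maxCost * (M.minAbandonProb ^ 2)⁻¹) *
        (√N + M.numLevels * (2 * √(N * M.numLevels))) := by
  obtain ⟨γ, hγ, pos, hpos, hfollow⟩ := hπ
  obtain ⟨K, hK⟩ := M.sum_meanCost_le_of_followsPriority hN hθ hγ hpos hfollow
  set v := N * ((M.arrivalRate : ℝ) * M.costToGo γ M.root - M.serviceRate * γ) with hv
  set E := 2 * (M.maxCost * (M.minAbandonProb ^ 2)⁻¹) *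
    (√N + M.numLevels * (2 * √(N * M.numLevels))) with hE
  have hE0 : 0 ≤ E := by
    have := M.maxCost_pos
    positivity
  -- Comparison with the price `0`. Nonnegativity allows the cost bound to pass from
  -- `ENNReal.ofReal` to real numbers.
  have hv0 : 0 ≤ v := by
    have h0 := hγ.2 (Set.mem_Ici.2 le_rfl)
    simp only [Set.mem_ofPred_eq, mul_zero, zero_sub] at h0
    have h1 := mul_nonneg M.arrivalRate.2.1 (M.costToGo_nonneg le_rfl M.root)
    exact mul_nonneg N.cast_nonneg (by linarith)
  have hup := M.longRunCost_le hK
  have hlow : ENNReal.ofReal v ≤ M.optimalCost N :=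
    le_iInf fun π' => M.le_longRunCost (M.le_sum_meanCost_add N π' hγ.1)
  have htop : M.longRunCost N π ≠ ⊤ := ne_top_of_le_ne_top ENNReal.ofReal_ne_top hup
  have hle : M.optimalCost N ≤ M.longRunCost N π := iInf_le _ π
  refine ⟨htop, sub_nonneg.2 (ENNReal.toReal_mono htop hle), ?_⟩
  have h1 : (M.longRunCost N π).toReal ≤ v + E :=
    ENNReal.toReal_le_of_le_ofReal (add_nonneg hv0 hE0) hup
  have h2 : v ≤ (M.optimalCost N).toReal :=
    (ENNReal.ofReal_le_iff_le_toReal (ne_top_of_le_ne_top htop hle)).1 hlow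
  rw [regret]
  linarith

/-- The regret is squeezed between `0` and a multiple of `√N` whose constant does not depend on the
chosen price or tie-breaking, so these may vary with `N`. -/
theorem asymptoticallyOptimal (hθ : 0 < M.minAbandonProb) {π : ℕ → FeasiblePolicy S}
    (hπ : ∀ N, M.IsOaRC (π N)) : M.AsymptoticallyOptimal π := by
  set C := 2 * (M.maxCost * (M.minAbandonProb ^ 2)⁻¹) *
    (1 + M.numLevels * (2 * √M.numLevels)) with hC
  have hlim : Filter.Tendsto (fun N : ℕ => C * (√(N : ℝ))⁻¹) Filter.atTop (nhds 0) := by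
    have h := (Real.tendsto_sqrt_atTop.comp tendsto_natCast_atTop_atTop).inv_tendsto_atTop
    simpa using h.const_mul C
  refine tendsto_of_tendsto_of_tendsto_of_le_of_le' tendsto_const_nhds hlim ?_ ?_
  · filter_upwards [Filter.eventually_ge_atTop 1] with N hN
    exact div_nonneg ((hπ N).longRunCost_ne_top_and_regret_le hθ hN).2.1 N.cast_nonneg
  · filter_upwards [Filter.eventually_ge_atTop 1] with N hN
    have hN' : (0 : ℝ) < N := by exact_mod_cast hN
    have h := ((hπ N).longRunCost_ne_top_and_regret_le hθ hN).2.2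
    have hs := Real.sqrt_pos.2 hN'
    rw [div_le_iff₀ hN']
    refine h.trans_eq ?_
    have hss := Real.mul_self_sqrt hN'.le
    rw [Real.sqrt_mul hN'.le]
    calc _ = C * √N := by rw [hC]; ring
      _ = C * (√N)⁻¹ * (√N * √N) := by field_simp
      _ = C * (√N)⁻¹ * N := by rw [hss]

/-- The logarithm enters only here, as slack: it is at least `1` because `55 > e`, and `2 + 4 l^1.5
≤ 6 l^1.5` for `l ≥ 1`. -/
theorem sqrt_bound_le_log_bound {x l : ℝ} (hx : 1 ≤ x) (hl : 1 ≤ l) {c : ℝ} (hc : 0 ≤ c)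
    {t : ℝ} (ht : 0 ≤ t) :
    2 * (c * t) * (√x + l * (2 * √(x * l))) ≤
      c * (1610 * t * l ^ (1.5 : ℝ) * Real.log (55 * x * l) ^ 2) * √x := by
  have hl0 : 0 < l := by linarith
  have hpow : l ^ (1.5 : ℝ) = l * √l := by
    rw [Real.sqrt_eq_rpow, show (1.5 : ℝ) = 1 + 1 / 2 by norm_num, Real.rpow_add hl0,
      Real.rpow_one]
  have hlog : 1 ≤ Real.log (55 * x * l) := by
    rw [Real.le_log_iff_exp_le (by positivity)]
    have h1 := Real.exp_one_lt_d9
    have h2 : 1 ≤ x * l := one_le_mul_of_one_le_of_one_le hx hl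
    nlinarith
  have hlog2 : 1 ≤ Real.log (55 * x * l) ^ 2 := one_le_pow₀ hlog
  have hlsl : 1 ≤ l * √l := one_le_mul_of_one_le_of_one_le hl (Real.one_le_sqrt.2 hl)
  rw [Real.sqrt_mul (by linarith), hpow]
  have h3 : 0 ≤ c * t * √x := by positivity
  have h4 : 2 + 4 * (l * √l) ≤ 1610 * (l * √l) * Real.log (55 * x * l) ^ 2 := by
    nlinarith
  calc _ = c * t * √x * (2 + 4 * (l * √l)) := by ring
    _ ≤ c * t * √x * (1610 * (l * √l) * Real.log (55 * x * l) ^ 2) :=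
      mul_le_mul_of_nonneg_left h4 h3
    _ = _ := by ring

end Model

end UncertainCostQueue

theorem theorem1 {S : Type*} [Fintype S] [DecidableEq S] (M : UncertainCostQueue.Model S)
    (hθ : 0 < M.minAbandonProb) :
    (∃ π : UncertainCostQueue.FeasiblePolicy S, M.IsOaRC π) ∧
    (∀ π : ℕ → UncertainCostQueue.FeasiblePolicy S, (∀ N, M.IsOaRC (π N)) →
      M.AsymptoticallyOptimal π) ∧
    (∀ N : ℕ, 1 ≤ N → ∀ π : UncertainCostQueue.FeasiblePolicy S, M.IsOaRC π →
      M.longRunCost N π ≠ ⊤ ∧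
      M.regret N π ≤ M.maxCost *
        (1610 * (M.minAbandonProb ^ 2)⁻¹ * (M.numLevels : ℝ) ^ (1.5 : ℝ) *
          Real.log (55 * N * M.numLevels) ^ 2) * √(N : ℝ)) := by
  refine ⟨M.exists_isOaRC hθ, fun π hπ => M.asymptoticallyOptimal hθ hπ, fun N hN π hπ => ?_⟩
  obtain ⟨htop, -, hle⟩ := hπ.longRunCost_ne_top_and_regret_le hθ hN
  refine ⟨htop, hle.trans ?_⟩
  exact UncertainCostQueue.Model.sqrt_bound_le_log_bound (by exact_mod_cast hN)
    (by exact_mod_cast Nat.le_add_left 1 _) M.maxCost_pos.le (by positivity)
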